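/- **Setting.** Let $\mathfrak g$ be the Kac–Moody Lie algebra over $\mathbb C$ attached to a realization of a generalized Cartan matrix, with Cartan subalgebra $\mathfrak h$. Put $\mathfrak g'=[\mathfrak g,\mathfrak g]$ and $\mathfrak h'=\mathfrak h\cap\mathfrak g'$, let $\mathfrak h''$ be a complement of $\mathfrak h'$ in $\mathfrak h$, and let $N^+$ be the sum of the positive root spaces. Let $A$ be a finitely generated commutative associative unital $\mathbb C$-algebra. For such an algebra $B$ (here $B=A$ or a quotient of $A$) let $\mathfrak g_B=(\mathfrak g'\otimes B)\oplus\mathfrak h''$ be the Lie algebra with $[X\otimes a,Y\otimes b]=[X,Y]\otimes ab$, $[h,X\otimes a]=[h,X]\otimes a$ and $[h,k]=0$ for $X,Y\in\mathfrak g'$, $a,b\in B$, $h,k\in\mathfrak h''$. Let $\psi:(\mathfrak h'\otimes A)\oplus\mathfrak h''\to\mathbb C$ be linear and let $V(\psi)$ be an irreducible $\mathfrak g_A$-module of highest weight $\psi$; that is, it is generated by a nonzero vector $v$ with $(N^+\otimes A)v=0$ and $h v=\psi(h)v$ for all $h\in(\mathfrak h'\otimes A)\oplus\mathfrak h''$.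 For $\mu\in\mathfrak h^*$ let $V_\mu$ be the space of vectors on which every $h\in\mathfrak h=(\mathfrak h'\otimes 1)\oplus\mathfrak h''$ acts by $\mu(h)$. Assume that $V(\psi)$ is integrable, i.e. $V(\psi)=\bigoplus_{\mu\in\mathfrak h^*}V_\mu$ and, for every real root $\alpha$, every root vector $X_\alpha\in\mathfrak g_\alpha$, every $a\in A$ and every $w\in V(\psi)$, some power of $X_\alpha\otimes a$ kills $w$. Assume also that all weight spaces $V_\mu$ are finite-dimensional. **Theorem 3.3.** There is an ideal $I$ of $A$ that is cofinite (i.e. $\dim_{\mathbb C}A/I<\infty$) and satisfies $\psi(\mathfrak h'\otimes I)=0$. For every such $I$, the ideal $J=\sqrt I$ is a cofinite radical ideal with the following properties. 1. $\mathfrak g'\otimes J$ acts as zero on $V(\psi)$, and the action of $\mathfrak g_A$ on $V(\psi)$ factors through $\mathfrak g_A\to\mathfrak g_{A/J}$, so $V(\psi)$ is a module for $(\mathfrak g'\otimes A/J)\oplus\mathfrak h''$. 2. There are an integer $k\ge 0$ and pairwise distinct algebra homomorphisms $\chi_1,\dots,\chi_k:A\to\mathbb C$ with $J=\bigcap_{i=1}^k\ker\chi_i$.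 The assignment $X\otimes(a+J)+h\mapsto(\chi_1(a)X,\dots,\chi_k(a)X)+h$ defines an isomorphism of Lie algebras $$(\mathfrak g'\otimes A/J)\oplus\mathfrak h''\;\cong\;\Big(\bigoplus_{k\text{ times}}\mathfrak g'\Big)\oplus\mathfrak h'',$$ where $\mathfrak h''$ acts on each copy of $\mathfrak g'$ by the adjoint action. Through it $V(\psi)$ is a module for $\big(\bigoplus_{k\text{ times}}\mathfrak g'\big)\oplus\mathfrak h''$, on which $(\chi_1(a)X,\dots,\chi_k(a)X)+h$ acts as $X\otimes a+h\in\mathfrak g_A$. -/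

import Mathlib

open scoped TensorProduct

namespace KacMoody

noncomputable section

/-- Generalized Cartan matrices. -/
structure IsGCM {ι : Type*} (C : Matrix ι ι ℤ) : Prop where
  diag : ∀ i, C i i = 2
  offDiag : ∀ i j, i ≠ j → C i j ≤ 0
  zero_symm : ∀ i j, C i j = 0 → C j i = 0

/-- A realization `(H, {α_i}, {α_i^∨})` of the matrix `C`: the simple roots and the simple coroots
are linearly independent, `⟨α_i^∨, α_j⟩ = C i j`, and `dim H = 2 n - rank C`. -/
structure Realization {ι : Type*} [Fintype ι] (C : Matrix ι ι ℤ)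
    (H : Type*) [AddCommGroup H] [Module ℂ H] where
  gcm : IsGCM C
  finiteDimensional : FiniteDimensional ℂ H
  root : ι → Module.Dual ℂ H
  coroot : ι → H
  linearIndependent_root : LinearIndependent ℂ root
  linearIndependent_coroot : LinearIndependent ℂ coroot
  root_coroot : ∀ i j, root j (coroot i) = (C i j : ℂ)
  finrank_add_rank :
    Module.finrank ℂ H + (C.map (fun z : ℤ => (z : ℂ))).rank = 2 * Fintype.card ι

/-- Generators `e_i`, `f_i` and the elements of the Cartan subalgebra. -/
inductive Gen (ι : Type*) (H : Type*)
  | e : ι → Gen ι H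
  | f : ι → Gen ι H
  | h : H → Gen ι H

/-- The generator `e_i` of the free Lie algebra. -/
abbrev Gen.freeE {ι : Type*} (H : Type*) (i : ι) : FreeLieAlgebra ℂ (Gen ι H) :=
  FreeLieAlgebra.of ℂ (Gen.e i)

/-- The generator `f_i` of the free Lie algebra. -/
abbrev Gen.freeF {ι : Type*} (H : Type*) (i : ι) : FreeLieAlgebra ℂ (Gen ι H) :=
  FreeLieAlgebra.of ℂ (Gen.f i)

/-- The generator `t` of the free Lie algebra, for `t ∈ H`. -/
abbrev Gen.freeH (ι : Type*) {H : Type*} (t : H) : FreeLieAlgebra ℂ (Gen ι H) :=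
  FreeLieAlgebra.of ℂ (Gen.h t)

/-- Every vector space regarded as an abelian Lie algebra. -/
def AbelianLie (T : Type*) : Type _ := T

namespace AbelianLie

variable (T : Type*) [AddCommGroup T] [Module ℂ T]

instance : AddCommGroup (AbelianLie T) := inferInstanceAs (AddCommGroup T)

instance : Module ℂ (AbelianLie T) := inferInstanceAs (Module ℂ T)

instance : LieRing (AbelianLie T) where
  bracket _ _ := 0
  add_lie _ _ _ := (add_zero _).symm
  lie_add _ _ _ := (add_zero _).symm
  lie_self _ := rfl
  leibniz_lie _ _ _ := (add_zero _).symm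

instance : LieAlgebra ℂ (AbelianLie T) where
  lie_smul c _ _ := (smul_zero c).symm

/-- The identity map from `T` to the abelian Lie algebra on `T`. -/
def of : T ≃ₗ[ℂ] AbelianLie T := LinearEquiv.refl ℂ T

end AbelianLie

/-- The direct sum of `k` copies of a Lie algebra, with the componentwise bracket. -/
instance piLieRing (k : ℕ) (L : Type*) [LieRing L] : LieRing (Fin k → L) where
  bracket x y i := ⁅x i, y i⁆
  add_lie _ _ _ := funext fun _ => add_lie _ _ _
  lie_add _ _ _ := funext fun _ => lie_add _ _ _
  lie_self _ := funext fun _ => lie_self _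
  leibniz_lie _ _ _ := funext fun _ => leibniz_lie _ _ _

instance piLieAlgebra (k : ℕ) (L : Type*) [LieRing L] [LieAlgebra ℂ L] :
    LieAlgebra ℂ (Fin k → L) where
  lie_smul _ _ _ := funext fun _ => lie_smul _ _ _

namespace Realization

variable {ι : Type*} [Fintype ι] {C : Matrix ι ι ℤ} {H : Type*} [AddCommGroup H] [Module ℂ H]

/-- The relators of the auxiliary Lie algebra `g̃`: the generators `h t` depend linearly on `t`,
`[t, t'] = 0`, `[t, e_i] = α_i(t) e_i`, `[t, f_i] = -α_i(t) f_i`, `[e_i, f_j] = δ_ij α_i^∨`. -/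
inductive IsRelator (R : Realization C H) : FreeLieAlgebra ℂ (Gen ι H) → Prop
  | add (s t : H) : IsRelator R (Gen.freeH ι (s + t) - (Gen.freeH ι s + Gen.freeH ι t))
  | smul (c : ℂ) (t : H) : IsRelator R (Gen.freeH ι (c • t) - c • Gen.freeH ι t)
  | hh (s t : H) : IsRelator R ⁅Gen.freeH ι s, Gen.freeH ι t⁆
  | he (t : H) (i : ι) :
      IsRelator R (⁅Gen.freeH ι t, Gen.freeE H i⁆ - R.root i t • Gen.freeE H i)
  | hf (t : H) (i : ι) :
      IsRelator R (⁅Gen.freeH ι t, Gen.freeF H i⁆ + R.root i t • Gen.freeF H i)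
  | ef (i : ι) : IsRelator R (⁅Gen.freeE H i, Gen.freeF H i⁆ - Gen.freeH ι (R.coroot i))
  | ef_ne (i j : ι) (hij : i ≠ j) : IsRelator R ⁅Gen.freeE H i, Gen.freeF H j⁆

/-- The ideal generated by the relators. -/
def relatorIdeal (R : Realization C H) : LieIdeal ℂ (FreeLieAlgebra ℂ (Gen ι H)) :=
  LieSubmodule.lieSpan ℂ _ {x | R.IsRelator x}

/-- The auxiliary Lie algebra `g̃`. -/
def Aux (R : Realization C H) : Type _ := FreeLieAlgebra ℂ (Gen ι H) ⧸ R.relatorIdeal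

instance (R : Realization C H) : LieRing R.Aux :=
  inferInstanceAs (LieRing (FreeLieAlgebra ℂ (Gen ι H) ⧸ R.relatorIdeal))

instance (R : Realization C H) : LieAlgebra ℂ R.Aux :=
  inferInstanceAs (LieAlgebra ℂ (FreeLieAlgebra ℂ (Gen ι H) ⧸ R.relatorIdeal))

/-- The image in `g̃` of a generator. -/
def auxGen (R : Realization C H) (x : Gen ι H) : R.Aux :=
  LieSubmodule.Quotient.mk (N := R.relatorIdeal) (FreeLieAlgebra.of ℂ x)

/-- The largest ideal of `g̃` that meets the Cartan subalgebra trivially, as the sum of all the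
ideals with this property. -/
def maxIdeal (R : Realization C H) : LieIdeal ℂ R.Aux :=
  sSup {I | ∀ t : H, R.auxGen (Gen.h t) ∈ I → R.auxGen (Gen.h t) = 0}

/-- The Kac-Moody algebra `g` of the realization. -/
def Alg (R : Realization C H) : Type _ := R.Aux ⧸ R.maxIdeal

instance (R : Realization C H) : LieRing R.Alg :=
  inferInstanceAs (LieRing (R.Aux ⧸ R.maxIdeal))

instance (R : Realization C H) : LieAlgebra ℂ R.Alg :=
  inferInstanceAs (LieAlgebra ℂ (R.Aux ⧸ R.maxIdeal))

/-- The image in `g` of a generator. -/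
def gen (R : Realization C H) (x : Gen ι H) : R.Alg :=
  LieSubmodule.Quotient.mk (N := R.maxIdeal) (R.auxGen x)

/-- The embedding of the Cartan subalgebra `H` into `g`. -/
def cartan (R : Realization C H) : H →ₗ[ℂ] R.Alg where
  toFun t := R.gen (Gen.h t)
  map_add' s t := by
    have h : R.auxGen (Gen.h (s + t)) = R.auxGen (Gen.h s) + R.auxGen (Gen.h t) := by
      refine (Submodule.Quotient.eq R.relatorIdeal.toSubmodule).2 ?_
      exact LieSubmodule.subset_lieSpan (IsRelator.add (R := R) s t)
    exact congrArg (LieSubmodule.Quotient.mk (N := R.maxIdeal)) h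
  map_smul' c t := by
    have h : R.auxGen (Gen.h (c • t)) = c • R.auxGen (Gen.h t) := by
      refine (Submodule.Quotient.eq R.relatorIdeal.toSubmodule).2 ?_
      exact LieSubmodule.subset_lieSpan (IsRelator.smul (R := R) c t)
    exact congrArg (LieSubmodule.Quotient.mk (N := R.maxIdeal)) h

theorem cartan_lie_cartan (R : Realization C H) (s t : H) : ⁅R.cartan s, R.cartan t⁆ = 0 := by
  have h : ⁅R.auxGen (Gen.h s), R.auxGen (Gen.h t)⁆ = 0 :=
    (LieSubmodule.Quotient.mk_eq_zero' (N := R.relatorIdeal)).2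
      (LieSubmodule.subset_lieSpan (IsRelator.hh (R := R) s t))
  exact congrArg (LieSubmodule.Quotient.mk (N := R.maxIdeal)) h

/-- The derived algebra `g' = [g, g]`. -/
def derived (R : Realization C H) : LieIdeal ℂ R.Alg :=
  ⁅(⊤ : LieIdeal ℂ R.Alg), (⊤ : LieIdeal ℂ R.Alg)⁆

/-- `h' = h ∩ g'`, as a subspace of `H`. -/
def cartan' (R : Realization C H) : Submodule ℂ H :=
  R.derived.toSubmodule.comap R.cartan

/-- The inclusion of `h'` in `g'`. -/
def cartanToDerived (R : Realization C H) : R.cartan' →ₗ[ℂ] R.derived :=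
  R.cartan.restrict (p := R.cartan') (q := R.derived.toSubmodule) fun _ ht => ht

/-- The root space `g_α`. -/
def rootSpace (R : Realization C H) (α : Module.Dual ℂ H) : Submodule ℂ R.Alg where
  carrier := {x | ∀ t : H, ⁅R.cartan t, x⁆ = α t • x}
  add_mem' hx hy t := by rw [lie_add, hx t, hy t, smul_add]
  zero_mem' t := by rw [lie_zero, smul_zero]
  smul_mem' c x hx t := by rw [lie_smul, hx t, smul_comm]

/-- Positive roots. -/
def IsPosRoot (R : Realization C H) (α : Module.Dual ℂ H) : Prop :=
  α ≠ 0 ∧ R.rootSpace α ≠ ⊥ ∧ ∃ n : ι → ℕ, α = ∑ i, n i • R.root i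

/-- `N⁺`, the sum of the positive root spaces. -/
def nPos (R : Realization C H) : Submodule ℂ R.Alg :=
  ⨆ (α : Module.Dual ℂ H) (_ : R.IsPosRoot α), R.rootSpace α

theorem eval_coroot_root (R : Realization C H) (i : ι) :
    Module.Dual.eval ℂ H (R.coroot i) (R.root i) = 2 := by
  rw [Module.Dual.eval_apply, R.root_coroot, R.gcm.diag]
  norm_num

/-- The Weyl group, acting on the dual of the Cartan subalgebra. -/
def weylGroup (R : Realization C H) : Subgroup (Module.Dual ℂ H ≃ₗ[ℂ] Module.Dual ℂ H) :=
  Subgroup.closure (Set.range fun i => Module.reflection (R.eval_coroot_root i))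

/-- Real roots: the images of the simple roots under the Weyl group. -/
def IsRealRoot (R : Realization C H) (α : Module.Dual ℂ H) : Prop :=
  ∃ w ∈ R.weylGroup, ∃ i, α = w (R.root i)

/-- The derivation `ad t` of `g'`, for `t` in the Cartan subalgebra. -/
def adCartan (R : Realization C H) (t : H) : LieDerivation ℂ R.derived R.derived where
  toLinearMap := LieModule.toEnd ℂ R.Alg R.derived (R.cartan t)
  leibniz' x y := by
    apply Subtype.ext
    change ⁅R.cartan t, ⁅(x : R.Alg), (y : R.Alg)⁆⁆ =
      ⁅(x : R.Alg), ⁅R.cartan t, (y : R.Alg)⁆⁆ - ⁅(y : R.Alg), ⁅R.cartan t, (x : R.Alg)⁆⁆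
    rw [leibniz_lie, ← lie_skew (y : R.Alg) ⁅R.cartan t, (x : R.Alg)⁆]
    abel

theorem adCartan_comm (R : Realization C H) (s t : H) (x : R.derived) :
    R.adCartan s (R.adCartan t x) = R.adCartan t (R.adCartan s x) := by
  apply Subtype.ext
  change ⁅R.cartan s, ⁅R.cartan t, (x : R.Alg)⁆⁆ = ⁅R.cartan t, ⁅R.cartan s, (x : R.Alg)⁆⁆
  rw [leibniz_lie, R.cartan_lie_cartan, zero_lie, zero_add]

theorem adCartan_add (R : Realization C H) (s t : H) (x : R.derived) :
    R.adCartan (s + t) x = R.adCartan s x + R.adCartan t x := by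
  apply Subtype.ext
  change ⁅R.cartan (s + t), (x : R.Alg)⁆ = ⁅R.cartan s, (x : R.Alg)⁆ + ⁅R.cartan t, (x : R.Alg)⁆
  rw [map_add, add_lie]

theorem adCartan_smul (R : Realization C H) (c : ℂ) (t : H) (x : R.derived) :
    R.adCartan (c • t) x = c • R.adCartan t x := by
  apply Subtype.ext
  change ⁅R.cartan (c • t), (x : R.Alg)⁆ = c • ⁅R.cartan t, (x : R.Alg)⁆
  rw [map_smul, smul_lie]

theorem adCartan_zero (R : Realization C H) (x : R.derived) : R.adCartan 0 x = 0 := by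
  have h := R.adCartan_smul 0 0 x
  rwa [zero_smul, zero_smul] at h

/-- The derivation `id ⊗ ad t` of `A ⊗ g'`. -/
def adTensor (R : Realization C H) (A : Type*) [CommRing A] [Algebra ℂ A] (t : H) :
    LieDerivation ℂ (A ⊗[ℂ] R.derived) (A ⊗[ℂ] R.derived) where
  toLinearMap := LinearMap.lTensor A (R.adCartan t : R.derived →ₗ[ℂ] R.derived)
  leibniz' x y := by
    induction x using TensorProduct.induction_on with
    | zero => simp
    | add x₁ x₂ h₁ h₂ => simp only [add_lie, lie_add, map_add, h₁, h₂]; abel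
    | tmul a x =>
      induction y using TensorProduct.induction_on with
      | zero => simp
      | add y₁ y₂ h₁ h₂ => simp only [add_lie, lie_add, map_add, h₁, h₂]; abel
      | tmul b y =>
        simp only [LieAlgebra.ExtendScalars.bracket_tmul, LinearMap.lTensor_tmul,
          LieDerivation.coeFn_coe, LieDerivation.apply_lie_eq_sub, TensorProduct.tmul_sub,
          mul_comm b a]

theorem adTensor_tmul (R : Realization C H) (A : Type*) [CommRing A] [Algebra ℂ A] (t : H) (a : A)
    (x : R.derived) : R.adTensor A t (a ⊗ₜ x) = a ⊗ₜ R.adCartan t x := rfl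

/-- The action of the complement `h''` on `A ⊗ g'`. -/
def complAct (R : Realization C H) (S : Submodule ℂ H) (A : Type*) [CommRing A] [Algebra ℂ A] :
    AbelianLie S →ₗ⁅ℂ⁆ LieDerivation ℂ (A ⊗[ℂ] R.derived) (A ⊗[ℂ] R.derived) where
  toFun t := R.adTensor A ((AbelianLie.of S).symm t : H)
  map_add' s t := by
    ext y
    induction y using TensorProduct.induction_on with
    | zero => simp
    | add y₁ y₂ h₁ h₂ => rw [map_add, h₁, h₂, map_add]
    | tmul a x =>
      simp only [LieDerivation.add_apply, adTensor_tmul, map_add, Submodule.coe_add, adCartan_add,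
        TensorProduct.tmul_add]
  map_smul' c t := by
    ext y
    induction y using TensorProduct.induction_on with
    | zero => simp
    | add y₁ y₂ h₁ h₂ => rw [map_add, h₁, h₂, map_add]
    | tmul a x =>
      simp only [LieDerivation.smul_apply, adTensor_tmul, map_smul, Submodule.coe_smul,
        adCartan_smul, TensorProduct.tmul_smul, RingHom.id_apply]
  map_lie' {s t} := by
    ext y
    induction y using TensorProduct.induction_on with
    | zero => simp
    | add y₁ y₂ h₁ h₂ => simp only [map_add] at h₁ h₂ ⊢; rw [h₁, h₂]
    | tmul a x =>
      have h : (((AbelianLie.of S).symm ⁅s, t⁆ : S) : H) = 0 := rfl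
      rw [LieDerivation.lie_apply, h]
      simp only [adTensor_tmul]
      rw [adCartan_comm, sub_self, adCartan_zero, TensorProduct.tmul_zero]

/-- The current Kac-Moody algebra `g_A = (g' ⊗ A) ⊕ h''`, with
`[X ⊗ a, Y ⊗ b] = [X, Y] ⊗ ab`, `[h, X ⊗ a] = [h, X] ⊗ a` and `[h, k] = 0` for `h, k ∈ h''`. -/
abbrev Current (R : Realization C H) (S : Submodule ℂ H) (A : Type*) [CommRing A] [Algebra ℂ A] :
    Type _ :=
  LieAlgebra.SemiDirectSum (A ⊗[ℂ] R.derived) (AbelianLie S) (R.complAct S A)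

/-- The element `y + t` of `g_A`, for `y ∈ g' ⊗ A` and `t ∈ h''`. -/
abbrev Current.mk (R : Realization C H) (S : Submodule ℂ H) {A : Type*} [CommRing A] [Algebra ℂ A]
    (y : A ⊗[ℂ] R.derived) (t : S) : R.Current S A :=
  ⟨y, AbelianLie.of S t⟩

/-- The diagonal action of the complement `h''` on the direct sum of `k` copies of `g'`. -/
def complActCopies (R : Realization C H) (S : Submodule ℂ H) (k : ℕ) :
    AbelianLie S →ₗ⁅ℂ⁆ LieDerivation ℂ (Fin k → R.derived) (Fin k → R.derived) where
  toFun t :=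
    { toFun := fun x i => R.adCartan ((AbelianLie.of S).symm t : H) (x i)
      map_add' := fun x y => by ext1 i; simp
      map_smul' := fun c x => by ext1 i; simp
      leibniz' := fun x y => by
        ext1 i
        exact (R.adCartan ((AbelianLie.of S).symm t : H)).leibniz' (x i) (y i) }
  map_add' s t := by
    ext1 x; ext1 i
    exact R.adCartan_add _ _ (x i)
  map_smul' c t := by
    ext1 x; ext1 i
    exact R.adCartan_smul c _ (x i)
  map_lie' {s t} := by
    ext1 x; ext1 i
    rw [LieDerivation.lie_apply]
    refine Eq.trans (R.adCartan_zero (x i)) ?_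
    exact (sub_eq_zero.2 (R.adCartan_comm _ _ (x i))).symm

/-- The Lie algebra `(g' ⊕ ⋯ ⊕ g') ⊕ h''` with `k` copies of `g'`, on each of which `h''` acts by
the adjoint action. -/
abbrev Copies (R : Realization C H) (S : Submodule ℂ H) (k : ℕ) : Type _ :=
  LieAlgebra.SemiDirectSum (Fin k → R.derived) (AbelianLie S) (R.complActCopies S k)

/-- The element `(x_1, …, x_k) + t` of `(g' ⊕ ⋯ ⊕ g') ⊕ h''`. -/
abbrev Copies.mk (R : Realization C H) (S : Submodule ℂ H) {k : ℕ}
    (x : Fin k → R.derived) (t : S) : R.Copies S k :=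
  ⟨x, AbelianLie.of S t⟩

section Modules

variable (R : Realization C H) (S : Submodule ℂ H) (A : Type*) [CommRing A] [Algebra ℂ A]
  (V : Type*) [AddCommGroup V] [Module ℂ V] [LieRingModule (R.Current S A) V]
  [LieModule ℂ (R.Current S A) V]

/-- `V` is a highest weight module of highest weight `ψ : (h' ⊗ A) ⊕ h'' → ℂ`. -/
def IsHighestWeight (ψ : (A ⊗[ℂ] R.cartan') × S →ₗ[ℂ] ℂ) : Prop :=
  ∃ v : V, v ≠ 0 ∧
    LieSubmodule.lieSpan ℂ (R.Current S A) {v} = ⊤ ∧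
    (∀ (a : A) (x : R.derived), (x : R.Alg) ∈ R.nPos →
      ⁅Current.mk R S (a ⊗ₜ[ℂ] x) 0, v⁆ = 0) ∧
    (∀ (y : A ⊗[ℂ] R.cartan') (t : S),
      ⁅Current.mk R S (LinearMap.lTensor A R.cartanToDerived y) t, v⁆ = ψ (y, t) • v)

/-- The weight space `V_μ`, for `μ` in the dual of `h = h' ⊕ h''`, where `h'` acts through
`h' ⊗ 1`. -/
def weightSpace (μ : Module.Dual ℂ H) : Submodule ℂ V where
  carrier := {v | ∀ (s : R.cartan') (t : S),
    ⁅Current.mk R S ((1 : A) ⊗ₜ[ℂ] R.cartanToDerived s) t, v⁆ = μ (s + t) • v}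
  add_mem' hx hy s t := by rw [lie_add, hx s t, hy s t, smul_add]
  zero_mem' s t := by rw [lie_zero, smul_zero]
  smul_mem' c x hx s t := by rw [lie_smul, hx s t, smul_comm]

open Classical in
/-- `V` is integrable: it is the direct sum of its weight spaces, and real root vectors act locally
nilpotently. -/
def IsIntegrable : Prop :=
  DirectSum.IsInternal (fun μ : Module.Dual ℂ H => R.weightSpace S A V μ) ∧
  ∀ α : Module.Dual ℂ H, R.IsRealRoot α → ∀ x : R.derived, (x : R.Alg) ∈ R.rootSpace α →
    ∀ (a : A) (v : V), ∃ k : ℕ,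
      ((LieModule.toEnd ℂ (R.Current S A) V (Current.mk R S (a ⊗ₜ[ℂ] x) 0)) ^ k) v = 0

/-- All weight spaces of `V` are finite-dimensional. -/
def HasFiniteWeightSpaces : Prop :=
  ∀ μ : Module.Dual ℂ H, FiniteDimensional ℂ (R.weightSpace S A V μ)

end Modules

end Realization

/-- An ideal of finite codimension. -/
def IsCofinite {A : Type*} [CommRing A] [Algebra ℂ A] (I : Ideal A) : Prop :=
  FiniteDimensional ℂ (A ⧸ I)

end

end KacMoody

/-! Fix a highest weight vector `v` and let `annihilator i` be the set of `a` with `(f_i ⊗ a) v =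
0`. Bracketing with `α_i^∨ ⊗ b` gives `-2 f_i ⊗ ba`, so this set is an ideal. The intersection over
`i` is the kernel of a linear map from `A` to the product of the weight spaces of weight `λ - α_i`,
hence cofinite. Applying `e_i ⊗ 1` shows that `ψ` vanishes on `α_i^∨ ⊗ annihilator i`. The coroots
span `h'` by the triangular decomposition, so the intersection is one possible `I`.

Two facts handle an arbitrary `I`. By irreducibility, a vector strictly below `v` that all `e_j ⊗ b`
kill is zero (`eq_zero_of_maximal`). If `ψ` vanishes on `α_i^∨ ⊗ Aa`, then `(f_i ⊗ a) v` is such a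
vector, so `I` lies in every `annihilator i`. By integrability, these ideals are radical: if `f_i ⊗
a²` kills `v`, an `sl₂`-type computation with powers of `f_i ⊗ a` shows that nilpotency is possible
only when `ψ(α_i^∨ ⊗ a) = 0` (`map_coroot_eq_zero_of_sq`). Hence `J = √I` lies in every `annihilator
i`.

Induction on the length of brackets of the `f_i`, again through maximal vectors, gives `(g' ⊗ J) v =
0`. The vectors killed by `g' ⊗ J` form a submodule, so `g' ⊗ J` acts as zero (`curAct_eq_zero`) and
the action descends to `A/J`. This is a finite-dimensional reduced `ℂ`-algebra, thus `ℂ^k`; its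
coordinates are the characters, and tensoring with `g'` gives `k` copies. -/

namespace KacMoody

noncomputable section

/-! ### Iterated brackets of two families whose mutual brackets act diagonally. -/

section Words

variable {ι L : Type*} [LieRing L] [LieAlgebra ℂ L]

/-- The iterated bracket `[x_i, [x_j, [x_k, …]]]` along the nonempty list `i, j, k, …`. -/
def word (x : ι → L) : ι → List ι → L
  | i, [] => x i
  | i, j :: l => ⁅x i, word x j l⁆

/-- The span of the iterated brackets of length `n + 1`. -/
def wordLevel (x : ι → L) (n : ℕ) : Submodule ℂ L :=
  Submodule.span ℂ {y | ∃ i l, l.length = n ∧ y = word x i l}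

/-- The span of all the iterated brackets. -/
def wordSpan (x : ι → L) : Submodule ℂ L :=
  Submodule.span ℂ {y | ∃ i l, y = word x i l}

theorem word_mem_wordLevel (x : ι → L) (i : ι) (l : List ι) : word x i l ∈ wordLevel x l.length :=
  Submodule.subset_span ⟨i, l, rfl, rfl⟩

theorem word_mem_wordSpan (x : ι → L) (i : ι) (l : List ι) : word x i l ∈ wordSpan x :=
  Submodule.subset_span ⟨i, l, rfl⟩

theorem wordLevel_le_wordSpan (x : ι → L) (n : ℕ) : wordLevel x n ≤ wordSpan x := by
  refine Submodule.span_mono ?_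
  rintro _ ⟨i, l, -, rfl⟩
  exact ⟨i, l, rfl⟩

theorem lie_mem_of_mem_span {s : Set L} {z y : L} {U : Submodule ℂ L} (hy : y ∈ Submodule.span ℂ s)
    (h : ∀ u ∈ s, ⁅z, u⁆ ∈ U) : ⁅z, y⁆ ∈ U := by
  induction hy using Submodule.span_induction with
  | mem u hu => exact h u hu
  | zero => rw [lie_zero]; exact U.zero_mem
  | add u v _ _ hu hv => rw [lie_add]; exact U.add_mem hu hv
  | smul c u _ hu => rw [lie_smul]; exact U.smul_mem c hu

theorem lie_mem_wordLevel_succ (x : ι → L) (i : ι) {n : ℕ} {y : L} (hy : y ∈ wordLevel x n) :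
    ⁅x i, y⁆ ∈ wordLevel x (n + 1) := by
  refine lie_mem_of_mem_span hy ?_
  rintro _ ⟨j, l, rfl, rfl⟩
  exact word_mem_wordLevel x i (j :: l)

theorem lie_mem_wordSpan (x : ι → L) (i : ι) {y : L} (hy : y ∈ wordSpan x) :
    ⁅x i, y⁆ ∈ wordSpan x := by
  refine lie_mem_of_mem_span hy ?_
  rintro _ ⟨j, l, rfl⟩
  exact word_mem_wordSpan x i (j :: l)

variable {x y : ι → L} {T : Submodule ℂ L}

theorem lie_word_of_diagonal (hT : ∀ t ∈ T, ∀ i, ∃ c : ℂ, ⁅t, x i⁆ = c • x i) {t : L} (ht : t ∈ T)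
    (i : ι) (l : List ι) : ∃ c : ℂ, ⁅t, word x i l⁆ = c • word x i l := by
  induction l generalizing i with
  | nil => exact hT t ht i
  | cons j l ih =>
    obtain ⟨a, ha⟩ := hT t ht i
    obtain ⟨b, hb⟩ := ih j
    refine ⟨a + b, ?_⟩
    rw [word, leibniz_lie, ha, hb, smul_lie, lie_smul, add_smul]

/-- By Leibniz, `y j` either meets the first letter, giving an element of `T` that scales the tail,
or passes into the tail. Each time exactly one letter is lost. At least two letters are needed,
since a single letter is sent into `T`. -/
theorem lie_word_cons_mem_wordLevel (hT : ∀ t ∈ T, ∀ i, ∃ c : ℂ, ⁅t, x i⁆ = c • x i)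
    (hyx : ∀ j i, ⁅y j, x i⁆ ∈ T) (j i k : ι) (l : List ι) :
    ⁅y j, word x i (k :: l)⁆ ∈ wordLevel x l.length := by
  induction l generalizing i k with
  | nil =>
    rw [word, leibniz_lie]
    refine Submodule.add_mem _ ?_ ?_
    · obtain ⟨c, hc⟩ := lie_word_of_diagonal hT (hyx j i) k []
      rw [hc]
      exact Submodule.smul_mem _ _ (word_mem_wordLevel x k [])
    · obtain ⟨c, hc⟩ := hT _ (hyx j k) i
      change ⁅x i, ⁅y j, x k⁆⁆ ∈ _
      rw [← lie_skew, hc]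
      exact Submodule.neg_mem _ (Submodule.smul_mem _ _ (word_mem_wordLevel x i []))
  | cons k' l ih =>
    rw [word, leibniz_lie]
    refine Submodule.add_mem _ ?_ ?_
    · obtain ⟨c, hc⟩ := lie_word_of_diagonal hT (hyx j i) k (k' :: l)
      rw [hc]
      exact Submodule.smul_mem _ _ (word_mem_wordLevel x k (k' :: l))
    · exact lie_mem_wordLevel_succ x i (ih k k')

theorem lie_mem_sup_wordSpan (hT : ∀ t ∈ T, ∀ i, ∃ c : ℂ, ⁅t, x i⁆ = c • x i)
    (hyx : ∀ j i, ⁅y j, x i⁆ ∈ T) (j : ι) {z : L} (hz : z ∈ wordSpan x) :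
    ⁅y j, z⁆ ∈ T ⊔ wordSpan x := by
  refine lie_mem_of_mem_span hz ?_
  rintro _ ⟨i, l, rfl⟩
  cases l with
  | nil => exact Submodule.mem_sup_left (hyx j i)
  | cons k l =>
    exact Submodule.mem_sup_right
      (wordLevel_le_wordSpan _ _ (lie_word_cons_mem_wordLevel hT hyx j i k l))

theorem lie_mem_wordSpan_of_mem (hT : ∀ t ∈ T, ∀ i, ∃ c : ℂ, ⁅t, x i⁆ = c • x i) (i : ι) {t : L}
    (ht : t ∈ T) : ⁅x i, t⁆ ∈ wordSpan x := by
  obtain ⟨c, hc⟩ := hT t ht i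
  rw [← lie_skew, hc]
  exact Submodule.neg_mem _ (Submodule.smul_mem _ _ (word_mem_wordSpan x i []))

/-- The triangular span is stable under bracketing with the generators `x i`. -/
theorem lie_mem_triangular (hTx : ∀ t ∈ T, ∀ i, ∃ c : ℂ, ⁅t, x i⁆ = c • x i)
    (hTy : ∀ t ∈ T, ∀ i, ∃ c : ℂ, ⁅t, y i⁆ = c • y i) (hxy : ∀ j i, ⁅x j, y i⁆ ∈ T)
    (i : ι) {z : L} (hz : z ∈ T ⊔ wordSpan x ⊔ wordSpan y) :
    ⁅x i, z⁆ ∈ T ⊔ wordSpan x ⊔ wordSpan y := by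
  obtain ⟨u, hu, q, hq, rfl⟩ := Submodule.mem_sup.1 hz
  obtain ⟨t, ht, p, hp, rfl⟩ := Submodule.mem_sup.1 hu
  rw [lie_add, lie_add]
  refine Submodule.add_mem _ (Submodule.mem_sup_left (Submodule.mem_sup_right
    (Submodule.add_mem _ (lie_mem_wordSpan_of_mem hTx i ht) (lie_mem_wordSpan x i hp)))) ?_
  exact (sup_le_sup_right le_sup_left _ : T ⊔ wordSpan y ≤ _) (lie_mem_sup_wordSpan hTy hxy i hq)

end Words

/-! ### Triangular decomposition of `g'` and the grading by height. -/

namespace Realization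

variable {ι : Type*} [Fintype ι] {C : Matrix ι ι ℤ} {H : Type*} [AddCommGroup H] [Module ℂ H]
  (R : Realization C H)

/-- The projection of the free Lie algebra onto `g`. -/
def proj : FreeLieAlgebra ℂ (Gen ι H) →ₗ⁅ℂ⁆ R.Alg where
  toFun z := LieSubmodule.Quotient.mk (N := R.maxIdeal)
    (LieSubmodule.Quotient.mk (N := R.relatorIdeal) z : R.Aux)
  map_add' _ _ := rfl
  map_smul' _ _ := rfl
  map_lie' := rfl

theorem proj_surjective : Function.Surjective R.proj := fun z => by
  obtain ⟨u, rfl⟩ := Quotient.mk_surjective z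
  obtain ⟨w, rfl⟩ := Quotient.mk_surjective u
  exact ⟨w, rfl⟩

theorem proj_eq_zero_of_isRelator {z : FreeLieAlgebra ℂ (Gen ι H)} (hz : R.IsRelator z) :
    R.proj z = 0 := by
  have h : (LieSubmodule.Quotient.mk (N := R.relatorIdeal) z : R.Aux) = 0 :=
    (LieSubmodule.Quotient.mk_eq_zero' (N := R.relatorIdeal)).2 (LieSubmodule.subset_lieSpan hz)
  exact congrArg (LieSubmodule.Quotient.mk (N := R.maxIdeal)) h

theorem cartan_lie_gen_e (t : H) (i : ι) :
    ⁅R.cartan t, R.gen (Gen.e i)⁆ = R.root i t • R.gen (Gen.e i) :=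
  sub_eq_zero.1 (R.proj_eq_zero_of_isRelator (IsRelator.he t i))

theorem cartan_lie_gen_f (t : H) (i : ι) :
    ⁅R.cartan t, R.gen (Gen.f i)⁆ = -(R.root i t • R.gen (Gen.f i)) :=
  eq_neg_of_add_eq_zero_left (R.proj_eq_zero_of_isRelator (IsRelator.hf t i))

theorem gen_e_lie_gen_f (i : ι) : ⁅R.gen (Gen.e i), R.gen (Gen.f i)⁆ = R.cartan (R.coroot i) :=
  sub_eq_zero.1 (R.proj_eq_zero_of_isRelator (IsRelator.ef i))

theorem gen_e_lie_gen_f_of_ne {i j : ι} (hij : i ≠ j) : ⁅R.gen (Gen.e i), R.gen (Gen.f j)⁆ = 0 :=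
  R.proj_eq_zero_of_isRelator (IsRelator.ef_ne i j hij)

/-- The surjection `proj` from the free Lie algebra factors through `K`, since the lift into `K`
agrees with it on generators. -/
theorem eq_top_of_gen_mem (K : LieSubalgebra ℂ R.Alg) (h : ∀ x, R.gen x ∈ K) : K = ⊤ := by
  let F : FreeLieAlgebra ℂ (Gen ι H) →ₗ⁅ℂ⁆ K := FreeLieAlgebra.lift ℂ fun x => ⟨R.gen x, h x⟩
  have hF : K.incl.comp F = R.proj := by
    refine FreeLieAlgebra.hom_ext fun x => ?_
    rw [LieHom.comp_apply, FreeLieAlgebra.lift_of_apply]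
    rfl
  refine eq_top_iff.2 fun z _ => ?_
  obtain ⟨w, rfl⟩ := R.proj_surjective z
  rw [← hF]
  exact (F w).2

theorem root_coroot_self (i : ι) : R.root i (R.coroot i) = 2 := by
  rw [R.root_coroot, R.gcm.diag]; norm_num

theorem mem_derived_of_lie {t : H} {c : ℂ} (hc : c ≠ 0) {z : R.Alg} (h : ⁅R.cartan t, z⁆ = c • z) :
    z ∈ R.derived := by
  have h2 : z = c⁻¹ • ⁅R.cartan t, z⁆ := by rw [h, smul_smul, inv_mul_cancel₀ hc, one_smul]
  rw [h2]
  exact R.derived.smul_mem _ (LieSubmodule.lie_mem_lie (LieSubmodule.mem_top _)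
    (LieSubmodule.mem_top _))

/-- The generator `e_i` of `g'`. -/
def e (i : ι) : R.derived :=
  ⟨R.gen (Gen.e i), R.mem_derived_of_lie (t := R.coroot i) (c := 2) two_ne_zero (by
    rw [cartan_lie_gen_e, root_coroot_self])⟩

/-- The generator `f_i` of `g'`. -/
def f (i : ι) : R.derived :=
  ⟨R.gen (Gen.f i), R.mem_derived_of_lie (t := R.coroot i) (c := -2) (by norm_num) (by
    rw [cartan_lie_gen_f, root_coroot_self, neg_smul])⟩

theorem adCartan_coe (t : H) (z : R.derived) :
    ((R.adCartan t z : R.derived) : R.Alg) = ⁅R.cartan t, (z : R.Alg)⁆ := rfl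

theorem adCartan_e (t : H) (i : ι) : R.adCartan t (R.e i) = R.root i t • R.e i :=
  Subtype.ext (R.cartan_lie_gen_e t i)

theorem adCartan_f (t : H) (i : ι) : R.adCartan t (R.f i) = -(R.root i t • R.f i) :=
  Subtype.ext (R.cartan_lie_gen_f t i)

theorem coroot_mem_cartan' (i : ι) : R.coroot i ∈ R.cartan' := by
  change R.cartan (R.coroot i) ∈ R.derived
  rw [← gen_e_lie_gen_f]
  exact LieSubmodule.lie_mem_lie (LieSubmodule.mem_top _) (LieSubmodule.mem_top _)

/-- The coroot `α_i^∨` as an element of `h'`. -/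
def coroot' (i : ι) : R.cartan' := ⟨R.coroot i, R.coroot_mem_cartan' i⟩

theorem cartanToDerived_lie (s : R.cartan') (z : R.derived) :
    ⁅R.cartanToDerived s, z⁆ = R.adCartan s z := rfl

theorem e_lie_f (i : ι) : ⁅R.e i, R.f i⁆ = R.cartanToDerived (R.coroot' i) :=
  Subtype.ext (R.gen_e_lie_gen_f i)

theorem e_lie_f_of_ne {i j : ι} (hij : i ≠ j) : ⁅R.e i, R.f j⁆ = 0 :=
  Subtype.ext (R.gen_e_lie_gen_f_of_ne hij)

/-- The span of the coroots in `g'`. -/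
def corootSpan : Submodule ℂ R.derived :=
  Submodule.span ℂ (Set.range fun i => R.cartanToDerived (R.coroot' i))

theorem mem_range_of_mem_corootSpan {z : R.derived} (hz : z ∈ R.corootSpan) :
    ∃ s, R.cartanToDerived s = z := by
  have h : R.corootSpan ≤ LinearMap.range R.cartanToDerived := by
    refine Submodule.span_le.2 ?_
    rintro _ ⟨i, rfl⟩
    exact ⟨_, rfl⟩
  exact h hz

theorem corootSpan_lie_e {z : R.derived} (hz : z ∈ R.corootSpan) (i : ι) :
    ∃ c : ℂ, ⁅z, R.e i⁆ = c • R.e i := by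
  obtain ⟨s, rfl⟩ := R.mem_range_of_mem_corootSpan hz
  exact ⟨_, R.adCartan_e s i⟩

theorem corootSpan_lie_f {z : R.derived} (hz : z ∈ R.corootSpan) (i : ι) :
    ∃ c : ℂ, ⁅z, R.f i⁆ = c • R.f i := by
  obtain ⟨s, rfl⟩ := R.mem_range_of_mem_corootSpan hz
  exact ⟨-R.root i s, by rw [neg_smul]; exact R.adCartan_f s i⟩

theorem e_lie_f_mem (i j : ι) : ⁅R.e i, R.f j⁆ ∈ R.corootSpan := by
  rcases eq_or_ne i j with rfl | hij
  · rw [e_lie_f]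
    exact Submodule.subset_span ⟨i, rfl⟩
  · rw [R.e_lie_f_of_ne hij]
    exact Submodule.zero_mem _

theorem f_lie_e_mem (i j : ι) : ⁅R.f i, R.e j⁆ ∈ R.corootSpan := by
  rw [← lie_skew]
  exact Submodule.neg_mem _ (R.e_lie_f_mem j i)

theorem adCartan_word {t : H} {x : ι → R.derived} {c : ι → ℂ} (hx : ∀ i, R.adCartan t (x i) = c i • x i)
    (i : ι) (l : List ι) : R.adCartan t (word x i l) = (c i + (l.map c).sum) • word x i l := by
  induction l generalizing i with
  | nil => simp [word, hx]
  | cons j l ih =>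
    rw [word, LieDerivation.apply_lie_eq_add, hx, ih j, smul_lie, lie_smul, List.map_cons, List.sum_cons,
      ← add_smul, add_comm]

/-- The span of the coroots and of all the iterated brackets of the `e_i` and of the `f_i`. -/
def triangular : Submodule ℂ R.derived := R.corootSpan ⊔ wordSpan R.e ⊔ wordSpan R.f

theorem e_lie_mem_triangular (i : ι) {z : R.derived} (hz : z ∈ R.triangular) :
    ⁅R.e i, z⁆ ∈ R.triangular :=
  lie_mem_triangular (fun _ ht i => R.corootSpan_lie_e ht i) (fun _ ht i => R.corootSpan_lie_f ht i)
    R.e_lie_f_mem i hz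

theorem f_lie_mem_triangular (i : ι) {z : R.derived} (hz : z ∈ R.triangular) :
    ⁅R.f i, z⁆ ∈ R.triangular := by
  -- Exchanging the two word spans lets the general statement apply with `e` and `f` in opposite
  -- roles.
  rw [triangular, sup_right_comm] at hz ⊢
  exact lie_mem_triangular (fun _ ht i => R.corootSpan_lie_f ht i)
    (fun _ ht i => R.corootSpan_lie_e ht i) R.f_lie_e_mem i hz

theorem adCartan_mem_triangular (t : H) {z : R.derived} (hz : z ∈ R.triangular) :
    R.adCartan t z ∈ R.triangular := by
  have h : R.triangular ≤ R.triangular.comap (R.adCartan t : R.derived →ₗ[ℂ] R.derived) := by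
    refine sup_le (sup_le (Submodule.span_le.2 ?_) (Submodule.span_le.2 ?_)) (Submodule.span_le.2 ?_)
    · rintro _ ⟨i, rfl⟩
      have : R.adCartan t (R.cartanToDerived (R.coroot' i)) = 0 :=
        Subtype.ext (R.cartan_lie_cartan t _)
      rw [SetLike.mem_coe, Submodule.mem_comap, LieDerivation.coeFn_coe]
      rw [this]
      exact Submodule.zero_mem _
    · rintro _ ⟨i, l, rfl⟩
      rw [SetLike.mem_coe, Submodule.mem_comap, LieDerivation.coeFn_coe]
      rw [R.adCartan_word (fun i => R.adCartan_e t i)]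
      exact Submodule.smul_mem _ _ (Submodule.mem_sup_left (Submodule.mem_sup_right
        (word_mem_wordSpan _ i l)))
    · rintro _ ⟨i, l, rfl⟩
      rw [SetLike.mem_coe, Submodule.mem_comap, LieDerivation.coeFn_coe]
      rw [R.adCartan_word (c := fun i => -R.root i t) (fun i => by rw [R.adCartan_f, neg_smul])]
      exact Submodule.smul_mem _ _ (Submodule.mem_sup_right (word_mem_wordSpan _ i l))
  exact h hz

/-- The image of `triangular` in `g` is an ideal. -/
theorem lie_mem_map_triangular (y : R.Alg) {z : R.Alg}
    (hz : z ∈ R.triangular.map R.derived.toSubmodule.subtype) :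
    ⁅y, z⁆ ∈ R.triangular.map R.derived.toSubmodule.subtype := by
  -- The elements that stabilize a subspace form a subalgebra, so only generators have to be tested.
  let K : LieSubalgebra ℂ R.Alg :=
    { carrier := {y | ∀ z ∈ R.triangular.map R.derived.toSubmodule.subtype,
        ⁅y, z⁆ ∈ R.triangular.map R.derived.toSubmodule.subtype}
      add_mem' := fun ha hb z hz => by
        rw [add_lie]; exact Submodule.add_mem _ (ha z hz) (hb z hz)
      zero_mem' := fun z _ => by rw [zero_lie]; exact Submodule.zero_mem _
      smul_mem' := fun c a ha z hz => by rw [smul_lie]; exact Submodule.smul_mem _ _ (ha z hz)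
      lie_mem' := fun {a b} ha hb z hz => by
        rw [lie_lie]; exact Submodule.sub_mem _ (ha _ (hb z hz)) (hb _ (ha z hz)) }
  have hK : K = ⊤ := by
    refine R.eq_top_of_gen_mem K fun x => ?_
    rintro _ ⟨z, hz, rfl⟩
    cases x with
    | e i => exact ⟨_, R.e_lie_mem_triangular i hz, rfl⟩
    | f i => exact ⟨_, R.f_lie_mem_triangular i hz, rfl⟩
    | h t => exact ⟨_, R.adCartan_mem_triangular t hz, rfl⟩
  exact (hK ▸ LieSubalgebra.mem_top y : y ∈ K) z hz

/-- An ideal plus the abelian Cartan subalgebra is a subalgebra, and this one contains all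
generators. -/
theorem exists_eq_add_cartan (y : R.Alg) :
    ∃ u ∈ R.triangular.map R.derived.toSubmodule.subtype, ∃ t : H, y = u + R.cartan t := by
  let K : LieSubalgebra ℂ R.Alg :=
    { (R.triangular.map R.derived.toSubmodule.subtype ⊔ LinearMap.range R.cartan) with
      lie_mem' := fun {a b} ha hb => by
        obtain ⟨u, hu, _, ⟨s, rfl⟩, rfl⟩ := Submodule.mem_sup.1 ha
        obtain ⟨w, hw, _, ⟨t, rfl⟩, rfl⟩ := Submodule.mem_sup.1 hb
        refine Submodule.mem_sup_left ?_
        rw [lie_add, add_lie, add_lie, R.cartan_lie_cartan, add_zero, ← lie_skew u (R.cartan t)]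
        exact Submodule.add_mem _ (Submodule.add_mem _ (R.lie_mem_map_triangular _ hw)
          (R.lie_mem_map_triangular _ hw)) (Submodule.neg_mem _ (R.lie_mem_map_triangular _ hu)) }
  have hK : K = ⊤ := by
    refine R.eq_top_of_gen_mem K fun x => ?_
    cases x with
    | e i => exact Submodule.mem_sup_left ⟨R.e i, Submodule.mem_sup_left (Submodule.mem_sup_right
        (word_mem_wordSpan R.e i [])), rfl⟩
    | f i => exact Submodule.mem_sup_left ⟨R.f i, Submodule.mem_sup_right
        (word_mem_wordSpan R.f i []), rfl⟩
    | h t => exact Submodule.mem_sup_right ⟨t, rfl⟩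
  obtain ⟨u, hu, _, ⟨t, rfl⟩, h⟩ := Submodule.mem_sup.1 (hK ▸ LieSubalgebra.mem_top y : y ∈ K)
  exact ⟨u, hu, t, h.symm⟩

/-- `g'` is spanned by brackets. In a bracket of two sums of a triangular and a Cartan element, the
Cartan-Cartan term vanishes and the others stay in the ideal. -/
theorem triangular_eq_top : R.triangular = ⊤ := by
  have h : R.derived.toSubmodule ≤ R.triangular.map R.derived.toSubmodule.subtype := by
    refine (LieSubmodule.lieIdeal_oper_eq_linear_span' (I := (⊤ : LieIdeal ℂ R.Alg))
      (N := (⊤ : LieIdeal ℂ R.Alg))).trans_le (Submodule.span_le.2 ?_)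
    rintro _ ⟨a, -, b, -, rfl⟩
    obtain ⟨u, hu, s, rfl⟩ := R.exists_eq_add_cartan a
    obtain ⟨w, hw, t, rfl⟩ := R.exists_eq_add_cartan b
    change _ ∈ Submodule.map _ _
    rw [lie_add, add_lie, add_lie, R.cartan_lie_cartan, add_zero, ← lie_skew u (R.cartan t)]
    exact Submodule.add_mem _ (Submodule.add_mem _ (R.lie_mem_map_triangular _ hw)
      (R.lie_mem_map_triangular _ hw)) (Submodule.neg_mem _ (R.lie_mem_map_triangular _ hu))
  refine eq_top_iff.2 fun z _ => ?_
  obtain ⟨u, hu, huz⟩ := h z.2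
  rwa [← Subtype.ext (a1 := u) (a2 := z) huz]

/-- An element of the Cartan subalgebra on which all the simple roots take the value `1`. -/
theorem exists_grading_element : ∃ t : H, ∀ i, R.root i t = 1 := by
  have := R.finiteDimensional
  -- Independence of the simple roots allows a functional on the dual with value `1` at each of
  -- them; by reflexivity it is evaluation at an element of `H`.
  obtain ⟨g, hg⟩ := LinearMap.exists_extend
    ((Module.Basis.span R.linearIndependent_root).constr ℂ fun _ => (1 : ℂ))
  refine ⟨(Module.evalEquiv ℂ H).symm g, fun i => ?_⟩
  rw [Module.apply_evalEquiv_symm_apply]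
  have h2 := congrArg (fun k => k (Module.Basis.span R.linearIndependent_root i)) hg
  simpa [Module.Basis.span_apply] using h2

theorem adCartan_word_e {t : H} (ht : ∀ i, R.root i t = 1) (i : ι) (l : List ι) :
    R.adCartan t (word R.e i l) = ((l.length + 1 : ℕ) : ℂ) • word R.e i l := by
  rw [R.adCartan_word (c := fun _ => 1) (fun i => by rw [R.adCartan_e, ht])]
  simp [add_comm]

theorem adCartan_word_f {t : H} (ht : ∀ i, R.root i t = 1) (i : ι) (l : List ι) :
    R.adCartan t (word R.f i l) = (-((l.length + 1 : ℕ) : ℂ)) • word R.f i l := by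
  rw [R.adCartan_word (c := fun _ => -1) (fun i => by rw [R.adCartan_f, ht, neg_smul])]
  simp [add_comm]

theorem wordSpan_le_iSup_eigenspace (D : Module.End ℂ R.derived) (x : ι → R.derived)
    (h : ∀ i l, ∃ c : ℂ, c ≠ 0 ∧ D (word x i l) = c • word x i l) :
    wordSpan x ≤ ⨆ (c : ℂ) (_ : c ≠ 0), D.eigenspace c := by
  refine Submodule.span_le.2 ?_
  rintro _ ⟨i, l, rfl⟩
  obtain ⟨c, hc, hD⟩ := h i l
  exact Submodule.mem_iSup_of_mem c (Submodule.mem_iSup_of_mem hc (Module.End.mem_eigenspace_iff.2 hD))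

/-- `h'` is spanned by the coroots. -/
theorem cartanToDerived_mem_corootSpan (s : R.cartan') : R.cartanToDerived s ∈ R.corootSpan := by
  obtain ⟨t, ht⟩ := R.exists_grading_element
  set D : Module.End ℂ R.derived := (R.adCartan t : R.derived →ₗ[ℂ] R.derived)
  have hD (s : R.cartan') : D (R.cartanToDerived s) = 0 := Subtype.ext (R.cartan_lie_cartan t _)
  have hs : R.cartanToDerived s ∈ R.triangular := R.triangular_eq_top ▸ Submodule.mem_top
  obtain ⟨u, hu, q, hq, h1⟩ := Submodule.mem_sup.1 hs
  obtain ⟨c, hc, p, hp, rfl⟩ := Submodule.mem_sup.1 hu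
  -- Words have height plus or minus their length, never `0`, whereas Cartan elements have height
  -- `0`. Independence of eigenspaces therefore kills the word part `p + q`.
  have hpq : p + q ∈ ⨆ (c : ℂ) (_ : c ≠ 0), D.eigenspace c := by
    refine Submodule.add_mem _ (R.wordSpan_le_iSup_eigenspace D R.e (fun i l => ?_) hp)
      (R.wordSpan_le_iSup_eigenspace D R.f (fun i l => ?_) hq)
    · exact ⟨_, Nat.cast_ne_zero.2 (Nat.succ_ne_zero _), R.adCartan_word_e ht i l⟩
    · exact ⟨_, neg_ne_zero.2 (Nat.cast_ne_zero.2 (Nat.succ_ne_zero _)), R.adCartan_word_f ht i l⟩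
  have hpq0 : p + q ∈ D.eigenspace 0 := by
    obtain ⟨s', rfl⟩ := R.mem_range_of_mem_corootSpan hc
    have : p + q = R.cartanToDerived s - R.cartanToDerived s' := by rw [← h1]; abel
    rw [Module.End.mem_eigenspace_iff, zero_smul, this, map_sub, hD, hD, sub_zero]
  have h0 := Submodule.disjoint_def.1 (D.eigenspaces_iSupIndep 0) _ hpq0 hpq
  rw [← h1, add_assoc, h0, add_zero]
  exact hc

theorem word_e_mem_nPos (i : ι) (l : List ι) : ((word R.e i l : R.derived) : R.Alg) ∈ R.nPos := by
  classical
  by_cases h0 : word R.e i l = 0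
  · rw [h0]; exact Submodule.zero_mem _
  have hw (t : H) : ⁅R.cartan t, ((word R.e i l : R.derived) : R.Alg)⁆ =
      (R.root i + (l.map R.root).sum) t • ((word R.e i l : R.derived) : R.Alg) := by
    have h := congrArg Subtype.val (R.adCartan_word (fun i => R.adCartan_e t i) i l)
    rw [adCartan_coe] at h
    rw [h, LinearMap.add_apply]
    have hap := map_list_sum (LinearMap.applyₗ t : Module.Dual ℂ H →ₗ[ℂ] ℂ) (l.map R.root)
    rw [List.map_map] at hap
    exact congrArg (fun c => (R.root i t + c) • ((word R.e i l : R.derived) : R.Alg)) hap.symm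
  have hsum (l : List ι) : (l.map R.root).sum = ∑ j, l.count j • R.root j := by
    induction l with
    | nil => simp
    | cons k l ih => simp [List.count_cons, add_smul, Finset.sum_add_distrib, ih, add_comm]
  refine Submodule.mem_iSup_of_mem (R.root i + (l.map R.root).sum) (Submodule.mem_iSup_of_mem
    ⟨?_, ?_, fun j => (i :: l).count j, ?_⟩ hw)
  -- Were the weight zero, a grading element would kill the word, but it scales the word by its
  -- positive length.
  · intro h
    obtain ⟨t, ht⟩ := R.exists_grading_element
    have h2 := R.adCartan_word_e ht i l
    have h3 : R.adCartan t (word R.e i l) = 0 := Subtype.ext (by rw [adCartan_coe, hw, h]; simp)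
    rw [h3] at h2
    exact (smul_ne_zero (Nat.cast_ne_zero.2 (Nat.succ_ne_zero _)) h0) h2.symm
  · intro h
    refine h0 (Subtype.ext ((Submodule.mem_bot ℂ).1 (h ▸ hw)))
  · rw [← hsum]; rfl

end Realization

end

end KacMoody

/-! ### Operators of the current algebra, stable subspaces and maximal vectors. -/

namespace KacMoody

noncomputable section

namespace Realization

variable {ι : Type*} [Fintype ι] {C : Matrix ι ι ℤ} {H : Type*} [AddCommGroup H] [Module ℂ H]
  (R : Realization C H) (S : Submodule ℂ H) {A : Type*} [CommRing A] [Algebra ℂ A]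
  {V : Type*} [AddCommGroup V] [Module ℂ V] [LieRingModule (R.Current S A) V]
  [LieModule ℂ (R.Current S A) V]

section Current

variable (A V) in
/-- The action of `x ⊗ a` on a `g_A`-module, for `x ∈ g'`. -/
def curAct : A →ₗ[ℂ] R.derived →ₗ[ℂ] Module.End ℂ V :=
  TensorProduct.curry ((LieModule.toEnd ℂ (R.Current S A) V : R.Current S A →ₗ[ℂ] Module.End ℂ V) ∘ₗ
    (LieAlgebra.SemiDirectSum.inl (R.complAct S A) : A ⊗[ℂ] R.derived →ₗ[ℂ] R.Current S A))

theorem curAct_apply (a : A) (x : R.derived) (w : V) :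
    R.curAct S A V a x w = ⁅Current.mk R S (a ⊗ₜ[ℂ] x) 0, w⁆ := rfl

variable (A V) in
/-- The action of the element `s + t` of the Cartan subalgebra on a `g_A`-module. -/
def cartAct (s : R.cartan') (t : S) : Module.End ℂ V :=
  LieModule.toEnd ℂ (R.Current S A) V (Current.mk R S (1 ⊗ₜ[ℂ] R.cartanToDerived s) t)

theorem cartAct_apply (s : R.cartan') (t : S) (w : V) :
    R.cartAct S A V s t w = ⁅Current.mk R S ((1 : A) ⊗ₜ[ℂ] R.cartanToDerived s) t, w⁆ := rfl

theorem curAct_lie (a b : A) (x y : R.derived) (w : V) :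
    R.curAct S A V (a * b) ⁅x, y⁆ w =
      R.curAct S A V a x (R.curAct S A V b y w) - R.curAct S A V b y (R.curAct S A V a x w) := by
  simp only [curAct_apply]
  rw [← lie_lie]
  congr 1
  simp [LieAlgebra.SemiDirectSum.lie_eq_mk, Current.mk]

theorem curAct_curAct (a b : A) (x y : R.derived) (w : V) :
    R.curAct S A V a x (R.curAct S A V b y w) =
      R.curAct S A V (a * b) ⁅x, y⁆ w + R.curAct S A V b y (R.curAct S A V a x w) := by
  rw [curAct_lie, sub_add_cancel]

theorem cartAct_curAct (s : R.cartan') (t : S) (b : A) (y : R.derived) (w : V) :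
    R.cartAct S A V s t (R.curAct S A V b y w) =
      R.curAct S A V b (R.adCartan (s + t) y) w + R.curAct S A V b y (R.cartAct S A V s t w) := by
  simp only [curAct_apply, cartAct_apply]
  rw [← sub_eq_iff_eq_add, ← lie_lie]
  congr 1
  have h : R.complAct S A ((AbelianLie.of S) t) (b ⊗ₜ[ℂ] y) = b ⊗ₜ[ℂ] R.adCartan t y := rfl
  simp [LieAlgebra.SemiDirectSum.lie_eq_mk, Current.mk, h, adCartan_add, TensorProduct.tmul_add]
  rfl

theorem adCartan_cartanToDerived (t : H) (s : R.cartan') : R.adCartan t (R.cartanToDerived s) = 0 :=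
  Subtype.ext (R.cartan_lie_cartan t _)

theorem cartAct_comm (s s' : R.cartan') (t t' : S) (w : V) :
    R.cartAct S A V s t (R.cartAct S A V s' t' w) = R.cartAct S A V s' t' (R.cartAct S A V s t w) := by
  simp only [cartAct_apply]
  rw [← sub_eq_zero, ← lie_lie]
  have h (t : S) (s : R.cartan') :
      R.complAct S A ((AbelianLie.of S) t) ((1 : A) ⊗ₜ[ℂ] R.cartanToDerived s) = 0 := by
    change 1 ⊗ₜ[ℂ] R.adCartan t _ = 0
    rw [adCartan_cartanToDerived, TensorProduct.tmul_zero]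
  have h2 : ⁅Current.mk R S ((1 : A) ⊗ₜ[ℂ] R.cartanToDerived s) t,
      Current.mk R S ((1 : A) ⊗ₜ[ℂ] R.cartanToDerived s') t'⁆ = 0 := by
    refine LieAlgebra.SemiDirectSum.ext ?_ rfl
    change ⁅(1 : A) ⊗ₜ[ℂ] R.cartanToDerived s, (1 : A) ⊗ₜ[ℂ] R.cartanToDerived s'⁆ +
      R.complAct S A ((AbelianLie.of S) t) ((1 : A) ⊗ₜ[ℂ] R.cartanToDerived s') -
      R.complAct S A ((AbelianLie.of S) t') ((1 : A) ⊗ₜ[ℂ] R.cartanToDerived s) = 0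
    rw [h, h, LieAlgebra.ExtendScalars.bracket_tmul, cartanToDerived_lie, adCartan_cartanToDerived]
    simp
  rw [h2, zero_lie]

variable {R S}

/-- A subspace that is stable under all `e_i ⊗ a` and `f_i ⊗ a` is stable under `g' ⊗ A`. -/
theorem curAct_mem_of_stable {M : Submodule ℂ V}
    (he : ∀ i (a : A), ∀ w ∈ M, R.curAct S A V a (R.e i) w ∈ M)
    (hf : ∀ i (a : A), ∀ w ∈ M, R.curAct S A V a (R.f i) w ∈ M)
    (x : R.derived) (a : A) {w : V} (hw : w ∈ M) : R.curAct S A V a x w ∈ M := by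
  let U : Submodule ℂ R.derived :=
    { carrier := {x | ∀ (a : A), ∀ w ∈ M, R.curAct S A V a x w ∈ M}
      add_mem' := fun hx hy a w hw => by
        rw [map_add]; exact M.add_mem (hx a w hw) (hy a w hw)
      zero_mem' := fun a w hw => by rw [map_zero]; exact M.zero_mem
      smul_mem' := fun c x hx a w hw => by rw [map_smul]; exact M.smul_mem c (hx a w hw) }
  have hlie {x y : R.derived} (hx : x ∈ U) (hy : y ∈ U) : ⁅x, y⁆ ∈ U := fun a w hw => by
    -- Writing `a = 1 * a` makes `[x, y] ⊗ a` the commutator of `x ⊗ 1` and `y ⊗ a`.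
    rw [← one_mul a, curAct_lie]
    exact M.sub_mem (hx _ _ (hy _ _ hw)) (hy _ _ (hx _ _ hw))
  have hword {y : ι → R.derived} (hy : ∀ i, y i ∈ U) (i : ι) (l : List ι) : word y i l ∈ U := by
    induction l generalizing i with
    | nil => exact hy i
    | cons j l ih => exact hlie (hy i) (ih j)
  have hU : R.triangular ≤ U := by
    refine sup_le (sup_le (Submodule.span_le.2 ?_) (Submodule.span_le.2 ?_)) (Submodule.span_le.2 ?_)
    · rintro _ ⟨i, rfl⟩
      change R.cartanToDerived (R.coroot' i) ∈ U
      rw [← e_lie_f]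
      exact hlie (he i) (hf i)
    · rintro _ ⟨i, l, rfl⟩
      exact hword he i l
    · rintro _ ⟨i, l, rfl⟩
      exact hword hf i l
  exact hU (R.triangular_eq_top ▸ Submodule.mem_top : x ∈ R.triangular) a w hw

/-- A subspace that is stable under `g' ⊗ A` and `h''` is a submodule. -/
def lieSubmoduleOfStable (M : Submodule ℂ V)
    (hx : ∀ (x : R.derived) (a : A), ∀ w ∈ M, R.curAct S A V a x w ∈ M)
    (ht : ∀ t : S, ∀ w ∈ M, R.cartAct S A V 0 t w ∈ M) : LieSubmodule ℂ (R.Current S A) V where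
  __ := M
  lie_mem := by
    rintro ⟨y, t⟩ w hw
    have h1 : (⟨y, t⟩ : R.Current S A) =
        Current.mk R S y 0 + Current.mk R S ((1 : A) ⊗ₜ[ℂ] R.cartanToDerived 0) t := by
      refine LieAlgebra.SemiDirectSum.ext ?_ (zero_add t).symm
      change y = y + 1 ⊗ₜ[ℂ] R.cartanToDerived 0
      rw [map_zero, TensorProduct.tmul_zero, add_zero]
    change ⁅(⟨y, t⟩ : R.Current S A), w⁆ ∈ M
    rw [h1, add_lie]
    refine M.add_mem ?_ (ht t w hw)
    clear h1
    induction y using TensorProduct.induction_on with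
    | zero =>
      have : Current.mk R S (0 : A ⊗[ℂ] R.derived) 0 = 0 := rfl
      rw [this, zero_lie]; exact M.zero_mem
    | add y z hy hz =>
      have : Current.mk R S (y + z) 0 = Current.mk R S y 0 + Current.mk R S z 0 := by
        simp [Current.mk]
      rw [this, add_lie]
      exact M.add_mem hy hz
    | tmul a x => exact hx x a w hw

theorem mem_lieSubmoduleOfStable {M : Submodule ℂ V}
    {hx : ∀ (x : R.derived) (a : A), ∀ w ∈ M, R.curAct S A V a x w ∈ M}
    {ht : ∀ t : S, ∀ w ∈ M, R.cartAct S A V 0 t w ∈ M} {w : V} :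
    w ∈ lieSubmoduleOfStable M hx ht ↔ w ∈ M := Iff.rfl

variable (R S A) in
/-- The vectors obtained from `K` by applying `n` operators of the form `f_i ⊗ a`. -/
inductive IsDescendant (K : Set V) : ℕ → V → Prop
  | base {w : V} (hw : w ∈ K) : IsDescendant K 0 w
  | step {n : ℕ} {w : V} (hw : IsDescendant K n w) (i : ι) (a : A) :
      IsDescendant K (n + 1) (R.curAct S A V a (R.f i) w)

/-- In an irreducible module with a vector `v ≠ 0` of degree `c`, a vector of degree `c - (n + 1)`
killed by all `e_i ⊗ a` is zero. -/
theorem eq_zero_of_maximal [LieModule.IsIrreducible ℂ (R.Current S A) V]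
    {s : R.cartan'} {t : S} (hst : ∀ i, R.root i (s + t) = 1) {v : V} (hv : v ≠ 0) {c : ℂ}
    (hvc : R.cartAct S A V s t v = c • v) (n : ℕ) {w : V}
    (hw : R.cartAct S A V s t w = (c - (n + 1 : ℕ)) • w)
    (hew : ∀ i (a : A), R.curAct S A V a (R.e i) w = 0) : w = 0 := by
  -- All maximal vectors of this degree are taken together: `α_i^∨ ⊗ a` and `h''` need not scale a
  -- single one, but they preserve the whole set.
  let K : Set V := {w | R.cartAct S A V s t w = (c - (n + 1 : ℕ)) • w ∧
    ∀ i (a : A), R.curAct S A V a (R.e i) w = 0}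
  let M : Submodule ℂ V := Submodule.span ℂ {w | ∃ m, IsDescendant R S A K m w}
  have hK : K ⊆ M := fun w hw => Submodule.subset_span ⟨0, .base hw⟩
  have extend {T : Module.End ℂ V} (hT : ∀ m w, IsDescendant R S A K m w → T w ∈ M) :
      ∀ w ∈ M, T w ∈ M := by
    have : M ≤ M.comap T := Submodule.span_le.2 fun w ⟨m, hw⟩ => hT m w hw
    exact fun w hw => this hw
  have hf (i) (a : A) : ∀ w ∈ M, R.curAct S A V a (R.f i) w ∈ M :=
    extend fun m w hw => Submodule.subset_span ⟨m + 1, hw.step i a⟩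
  -- The coroot and `e_i` statements go together, because moving `e_i ⊗ b` past `f_i ⊗ a` leaves
  -- `α_i^∨ ⊗ ba`.
  have key (m w) (hw : IsDescendant R S A K m w) :
      (∀ i (a : A), R.curAct S A V a (R.cartanToDerived (R.coroot' i)) w ∈ M) ∧
      (∀ i (a : A), R.curAct S A V a (R.e i) w ∈ M) ∧ ∀ t : S, R.cartAct S A V 0 t w ∈ M := by
    induction hw with
    | @base w hw =>
      refine ⟨fun i a => hK ⟨?_, fun j b => ?_⟩, fun i a => ?_, fun t' => hK ⟨?_, fun j b => ?_⟩⟩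
      · rw [cartAct_curAct, adCartan_cartanToDerived, hw.1]
        simp
      · rw [curAct_curAct, hw.2, map_zero, add_zero, ← lie_skew, cartanToDerived_lie, adCartan_e,
          map_neg, map_smul, LinearMap.neg_apply, LinearMap.smul_apply, hw.2]
        simp
      · rw [hw.2]; exact M.zero_mem
      · rw [cartAct_comm, hw.1, map_smul]
      · have h := R.cartAct_curAct S 0 t' b (R.e j) w
        rw [hw.2, map_zero, adCartan_e, map_smul, LinearMap.smul_apply, hw.2, smul_zero,
          zero_add] at h
        exact h.symm
    | @step m w hw k a ih =>
      refine ⟨fun i b => ?_, fun i b => ?_, fun t' => ?_⟩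
      · rw [curAct_curAct, cartanToDerived_lie, adCartan_f, map_neg, map_smul]
        refine M.add_mem (M.neg_mem (M.smul_mem _ ?_)) (hf _ _ _ (ih.1 i b))
        exact hf _ _ _ (Submodule.subset_span ⟨m, hw⟩)
      · rw [curAct_curAct]
        refine M.add_mem ?_ (hf _ _ _ (ih.2.1 i b))
        rcases eq_or_ne i k with rfl | hik
        · rw [e_lie_f]; exact ih.1 _ _
        · rw [R.e_lie_f_of_ne hik, map_zero]; exact M.zero_mem
      · rw [cartAct_curAct, adCartan_f, map_neg, map_smul]
        refine M.add_mem (M.neg_mem (M.smul_mem _ ?_)) (hf _ _ _ (ih.2.2 t'))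
        exact hf _ _ _ (Submodule.subset_span ⟨m, hw⟩)
  have hdeg (m w) (hw : IsDescendant R S A K m w) :
      R.cartAct S A V s t w = (c - (n + 1 + m : ℕ)) • w := by
    induction hw with
    | base hw => exact hw.1
    | @step m w hw k a ih =>
      rw [cartAct_curAct, ih, adCartan_f, hst, map_smul, one_smul, map_neg, LinearMap.neg_apply]
      push_cast
      module
  let N : LieSubmodule ℂ (R.Current S A) V := lieSubmoduleOfStable M
    (fun x a w hw => curAct_mem_of_stable (fun i a => extend fun m w hw => (key m w hw).2.1 i a)
      hf x a hw) (fun t => extend fun m w hw => (key m w hw).2.2 t)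
  -- Every degree occurring in `M` is `c - (n + 1 + m)`, which differs from `c`. So `v` is not in
  -- `M`, and this proper submodule must be zero.
  have hMle : M ≤ ⨆ (b : ℂ) (_ : b ≠ c), (R.cartAct S A V s t).eigenspace b := by
    refine Submodule.span_le.2 ?_
    rintro w ⟨m, hw⟩
    refine Submodule.mem_iSup_of_mem (c - (n + 1 + m : ℕ)) (Submodule.mem_iSup_of_mem ?_
      (Module.End.mem_eigenspace_iff.2 (hdeg m w hw)))
    rw [Ne, sub_eq_self, Nat.cast_eq_zero]
    omega
  have hvM : v ∉ M := fun h => hv (Submodule.disjoint_def.1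
    ((R.cartAct S A V s t).eigenspaces_iSupIndep c) v (Module.End.mem_eigenspace_iff.2 hvc) (hMle h))
  have hN : N = ⊥ := (IsSimpleOrder.eq_bot_or_eq_top N).resolve_right fun h =>
    hvM (mem_lieSubmoduleOfStable.1 (h ▸ LieSubmodule.mem_top v : v ∈ N))
  have hwN : w ∈ N := hK ⟨hw, hew⟩
  rw [hN] at hwN
  exact (LieSubmodule.mem_bot w).1 hwN

end Current

/-! ### Highest weight vectors and the annihilator ideals of the `f_i`. -/

variable (V) in
/-- `v` is a highest weight vector of weight `ψ`. -/
structure IsHighestWeightVector (ψ : (A ⊗[ℂ] R.cartan') × S →ₗ[ℂ] ℂ) (v : V) : Prop where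
  ne_zero : v ≠ 0
  word_e : ∀ (a : A) i l, R.curAct S A V a (word R.e i l) v = 0
  cartan' : ∀ (a : A) s, R.curAct S A V a (R.cartanToDerived s) v = ψ (a ⊗ₜ[ℂ] s, 0) • v
  cartan : ∀ s t, R.cartAct S A V s t v = ψ (1 ⊗ₜ[ℂ] s, t) • v

theorem IsHighestWeight.exists_vector {ψ : (A ⊗[ℂ] R.cartan') × S →ₗ[ℂ] ℂ}
    (h : R.IsHighestWeight S A V ψ) : ∃ v, R.IsHighestWeightVector S V ψ v := by
  obtain ⟨v, hv, -, hpos, hcar⟩ := h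
  exact ⟨v, hv, fun a i l => hpos a _ (R.word_e_mem_nPos i l), fun a s => hcar (a ⊗ₜ s) 0,
    fun s t => hcar (1 ⊗ₜ s) t⟩

namespace IsHighestWeightVector

variable {R S} {ψ : (A ⊗[ℂ] R.cartan') × S →ₗ[ℂ] ℂ} {v : V}

theorem curAct_e (hv : R.IsHighestWeightVector S V ψ v) (a : A) (i : ι) :
    R.curAct S A V a (R.e i) v = 0 := hv.word_e a i []

theorem e_f (hv : R.IsHighestWeightVector S V ψ v) (a b : A) (i : ι) :
    R.curAct S A V a (R.e i) (R.curAct S A V b (R.f i) v) =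
      ψ ((a * b) ⊗ₜ[ℂ] R.coroot' i, 0) • v := by
  rw [curAct_curAct, hv.curAct_e, map_zero, add_zero, e_lie_f, hv.cartan']

theorem e_f_of_ne (hv : R.IsHighestWeightVector S V ψ v) (a b : A) {i j : ι} (hij : i ≠ j) :
    R.curAct S A V a (R.e i) (R.curAct S A V b (R.f j) v) = 0 := by
  rw [curAct_curAct, hv.curAct_e, map_zero, add_zero, R.e_lie_f_of_ne hij, map_zero,
    LinearMap.zero_apply]

/-- The invertible factor `2 = α_i(α_i^∨)` lets `f_i ⊗ ab` be recovered from `f_i ⊗ b`; this is what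
makes `annihilator i` closed under multiplication by `A`. -/
theorem coroot_f (hv : R.IsHighestWeightVector S V ψ v) (a b : A) (i : ι) :
    R.curAct S A V a (R.cartanToDerived (R.coroot' i)) (R.curAct S A V b (R.f i) v) =
      ψ (a ⊗ₜ[ℂ] R.coroot' i, 0) • R.curAct S A V b (R.f i) v -
        (2 : ℂ) • R.curAct S A V (a * b) (R.f i) v := by
  have h : R.root i (R.coroot' i) = 2 := R.root_coroot_self i
  rw [curAct_curAct, hv.cartan', map_smul, cartanToDerived_lie, adCartan_f, h, map_neg, map_smul,
    LinearMap.neg_apply, LinearMap.smul_apply]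
  abel

/-- The ideal of all `a` such that `f_i ⊗ a` kills the highest weight vector. -/
def annihilator (hv : R.IsHighestWeightVector S V ψ v) (i : ι) : Ideal A where
  carrier := {a | R.curAct S A V a (R.f i) v = 0}
  add_mem' {a b} (ha : _ = _) (hb : _ = _) := by
    change _ = _
    rw [map_add, LinearMap.add_apply, LinearMap.add_apply, ha, hb, add_zero]
  zero_mem' := by change _ = _; rw [map_zero, LinearMap.zero_apply, LinearMap.zero_apply]
  smul_mem' b a (ha : _ = _) := by
    have h := hv.coroot_f b a i
    rw [ha, map_zero, smul_zero, zero_sub, eq_comm, neg_eq_zero] at h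
    exact (smul_eq_zero.1 h).resolve_left two_ne_zero

theorem mem_annihilator {hv : R.IsHighestWeightVector S V ψ v} {i : ι} {a : A} :
    a ∈ hv.annihilator i ↔ R.curAct S A V a (R.f i) v = 0 := Iff.rfl

/-- Apply `e_i ⊗ 1` to `(f_i ⊗ a) v = 0`. -/
theorem map_coroot_eq_zero (hv : R.IsHighestWeightVector S V ψ v) {i : ι} {a : A}
    (ha : a ∈ hv.annihilator i) : ψ (a ⊗ₜ[ℂ] R.coroot' i, 0) = 0 := by
  have h := hv.e_f 1 a i
  rw [mem_annihilator.1 ha, map_zero, one_mul] at h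
  exact (smul_eq_zero.1 h.symm).resolve_right hv.ne_zero

theorem map_cartan'_eq_zero (hv : R.IsHighestWeightVector S V ψ v) {a : A}
    (ha : ∀ i, a ∈ hv.annihilator i) (s : R.cartan') : ψ (a ⊗ₜ[ℂ] s, 0) = 0 := by
  have h : R.corootSpan ≤ LinearMap.ker ((R.curAct S A V a).flip v) := by
    refine Submodule.span_le.2 ?_
    rintro _ ⟨i, rfl⟩
    change R.curAct S A V a _ v = 0
    rw [hv.cartan', hv.map_coroot_eq_zero (ha i), zero_smul]
  have h2 : R.curAct S A V a _ v = 0 := h (R.cartanToDerived_mem_corootSpan s)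
  rw [hv.cartan'] at h2
  exact (smul_eq_zero.1 h2).resolve_right hv.ne_zero

/-- The operator of a grading element `s + t` lowers the degree of `v` by the length of a word in
the `f_i`. -/
theorem cartAct_word_f (hv : R.IsHighestWeightVector S V ψ v) {s : R.cartan'} {t : S}
    (hst : ∀ i, R.root i (s + t) = 1) (a : A) {n : ℕ} {y : R.derived} (hy : y ∈ wordLevel R.f n) :
    R.cartAct S A V s t (R.curAct S A V a y v) =
      (ψ (1 ⊗ₜ[ℂ] s, t) - (n + 1 : ℕ)) • R.curAct S A V a y v := by
  have hy' : R.adCartan (s + t) y = (-((n + 1 : ℕ) : ℂ)) • y := by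
    induction hy using Submodule.span_induction with
    | mem y hy =>
      obtain ⟨i, l, rfl, rfl⟩ := hy
      exact R.adCartan_word_f hst i l
    | zero => simp
    | add y z _ _ hy hz => rw [map_add, hy, hz, smul_add]
    | smul c y _ hy => rw [map_smul, hy, smul_comm]
  rw [cartAct_curAct, hv.cartan, hy', map_smul, map_smul, LinearMap.smul_apply]
  module

/-- If `f_i ⊗ a²` kills `v` and `f_i ⊗ a` is nilpotent on `v`, then `ψ` vanishes on
`α_i^∨ ⊗ a`. -/
theorem map_coroot_eq_zero_of_sq (hv : R.IsHighestWeightVector S V ψ v) {i : ι} {a : A}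
    (ha : a * a ∈ hv.annihilator i) {k : ℕ} (hk : ((R.curAct S A V a (R.f i)) ^ k) v = 0) :
    ψ (a ⊗ₜ[ℂ] R.coroot' i, 0) = 0 := by
  set c := ψ (a ⊗ₜ[ℂ] R.coroot' i, 0) with hc
  set F := R.curAct S A V a (R.f i) with hF
  -- `f_i ⊗ a²` commutes with `F`, so it kills every `F ^ n v` along with `v`.
  have hsq (n : ℕ) : R.curAct S A V (a * a) (R.f i) ((F ^ n) v) = 0 := by
    induction n with
    | zero => exact mem_annihilator.1 ha
    | succ n ih =>
      rw [pow_succ', Module.End.mul_apply, hF, curAct_curAct, ← hF, ih, lie_self, map_zero, map_zero,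
        add_zero, LinearMap.zero_apply]
  -- The commutator of `α_i^∨ ⊗ a` with `F` is `-2 f_i ⊗ a²`, which vanishes here, so the eigenvalue
  -- does not drop with `n`.
  have hh (n : ℕ) : R.curAct S A V a (R.cartanToDerived (R.coroot' i)) ((F ^ n) v) =
      c • (F ^ n) v := by
    induction n with
    | zero => exact hv.cartan' a _
    | succ n ih =>
      rw [pow_succ', Module.End.mul_apply, hF, curAct_curAct, ← hF, ih, cartanToDerived_lie, adCartan_f,
        map_neg, map_smul, LinearMap.neg_apply, LinearMap.smul_apply, hsq, smul_zero, neg_zero,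
        zero_add, map_smul]
  -- Unlike in the usual `sl₂` formula, the coefficient has no factor `c - n`. If `c ≠ 0` it never
  -- vanishes, so no power of `F` kills `v`.
  have he (n : ℕ) : R.curAct S A V 1 (R.e i) ((F ^ (n + 1)) v) = ((n + 1 : ℕ) * c) • (F ^ n) v := by
    induction n with
    | zero =>
      rw [zero_add, pow_one, hF, hv.e_f, one_mul, pow_zero, Nat.cast_one, one_mul,
        Module.End.one_apply]
    | succ n ih =>
      rw [pow_succ', Module.End.mul_apply, hF, curAct_curAct, ← hF, ih, e_lie_f, one_mul, hh, map_smul,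
        ← Module.End.mul_apply, ← pow_succ', ← add_smul]
      push_cast
      congr 1
      ring
  by_contra hc0
  have hne (n : ℕ) : (F ^ n) v ≠ 0 := by
    induction n with
    | zero => exact hv.ne_zero
    | succ n ih =>
      intro h
      have h2 := he n
      rw [h, map_zero, eq_comm] at h2
      exact smul_ne_zero (mul_ne_zero (Nat.cast_ne_zero.2 n.succ_ne_zero) hc0) ih h2
  exact hne k hk

/-! ### Consequences of irreducibility for the annihilator ideals. -/

section Irreducible

variable [LieModule.IsIrreducible ℂ (R.Current S A) V]

/-- `(f_i ⊗ a) v` is a maximal vector one degree below `v`: `e_i ⊗ b` sends it to `ψ(α_i^∨ ⊗ ba) v =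
0`, and the other `e_j ⊗ b` kill it anyway. -/
theorem mem_annihilator_of_map_eq_zero (hv : R.IsHighestWeightVector S V ψ v)
    (hS : IsCompl R.cartan' S) {i : ι} {a : A}
    (ha : ∀ b, ψ ((b * a) ⊗ₜ[ℂ] R.coroot' i, 0) = 0) : a ∈ hv.annihilator i := by
  obtain ⟨t₀, ht₀⟩ := R.exists_grading_element
  -- The grading element is split along `h' ⊕ h''` so that it acts on `V`.
  obtain ⟨s, hs, t, ht, rfl⟩ := Submodule.mem_sup.1 (hS.sup_eq_top ▸ Submodule.mem_top :
    t₀ ∈ R.cartan' ⊔ S)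
  refine eq_zero_of_maximal (s := ⟨s, hs⟩) (t := ⟨t, ht⟩) ht₀ hv.ne_zero (hv.cartan _ _) 0
    (hv.cartAct_word_f ht₀ a (word_mem_wordLevel R.f i [])) fun j b => ?_
  rcases eq_or_ne j i with rfl | hji
  · rw [hv.e_f, ha, zero_smul]
  · exact hv.e_f_of_ne b a hji

/-- Induction on length: `e_j ⊗ b` sends `(y ⊗ a) v` to `([e_j, y] ⊗ ba) v`, with a shorter bracket
and `ba` still in `J`. Hence `(y ⊗ a) v` is maximal of lower degree. -/
theorem curAct_wordLevel_f_eq_zero (hv : R.IsHighestWeightVector S V ψ v)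
    (hS : IsCompl R.cartan' S) {J : Ideal A} (hJ : ∀ i, J ≤ hv.annihilator i) (n : ℕ) {a : A}
    (ha : a ∈ J) {y : R.derived} (hy : y ∈ wordLevel R.f n) : R.curAct S A V a y v = 0 := by
  obtain ⟨t₀, ht₀⟩ := R.exists_grading_element
  obtain ⟨s, hs, t, ht, rfl⟩ := Submodule.mem_sup.1 (hS.sup_eq_top ▸ Submodule.mem_top :
    t₀ ∈ R.cartan' ⊔ S)
  induction n generalizing a y with
  | zero =>
    have h : wordLevel R.f 0 ≤ LinearMap.ker ((R.curAct S A V a).flip v) := by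
      refine Submodule.span_le.2 ?_
      rintro _ ⟨i, l, hl, rfl⟩
      rw [List.length_eq_zero_iff.1 hl]
      exact hJ i ha
    exact h hy
  | succ n ih =>
    refine eq_zero_of_maximal (s := ⟨s, hs⟩) (t := ⟨t, ht⟩) ht₀ hv.ne_zero (hv.cartan _ _) (n + 1)
      (hv.cartAct_word_f ht₀ a hy) fun j b => ?_
    rw [curAct_curAct, hv.curAct_e, map_zero, add_zero]
    refine ih (J.mul_mem_left b ha) (lie_mem_of_mem_span hy ?_)
    rintro _ ⟨i, l, hl, rfl⟩
    cases l with
    | nil => cases hl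
    | cons k l =>
      obtain rfl : l.length = n := Nat.succ.inj hl
      exact lie_word_cons_mem_wordLevel (fun _ ht i => R.corootSpan_lie_f ht i) R.e_lie_f_mem j i k l

theorem curAct_vector_eq_zero (hv : R.IsHighestWeightVector S V ψ v)
    (hS : IsCompl R.cartan' S) {J : Ideal A} (hJ : ∀ i, J ≤ hv.annihilator i) {a : A}
    (ha : a ∈ J) (x : R.derived) : R.curAct S A V a x v = 0 := by
  have h : R.triangular ≤ LinearMap.ker ((R.curAct S A V a).flip v) := by
    refine sup_le (sup_le (Submodule.span_le.2 ?_) (Submodule.span_le.2 ?_)) (Submodule.span_le.2 ?_)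
    · rintro _ ⟨i, rfl⟩
      change R.curAct S A V a _ v = 0
      rw [hv.cartan', hv.map_coroot_eq_zero (hJ i ha), zero_smul]
    · rintro _ ⟨i, l, rfl⟩
      exact hv.word_e a i l
    · rintro _ ⟨i, l, rfl⟩
      exact hv.curAct_wordLevel_f_eq_zero hS hJ _ ha (word_mem_wordLevel R.f i l)
  exact h (R.triangular_eq_top ▸ Submodule.mem_top : x ∈ R.triangular)

/-- If `f_i ⊗ J` kills the highest weight vector for all `i`, then `g' ⊗ J` acts as zero. -/
theorem curAct_eq_zero (hv : R.IsHighestWeightVector S V ψ v)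
    (hS : IsCompl R.cartan' S) {J : Ideal A} (hJ : ∀ i, J ≤ hv.annihilator i) {a : A}
    (ha : a ∈ J) (x : R.derived) (w : V) : R.curAct S A V a x w = 0 := by
  -- Since `g' ⊗ J` is an ideal of `g_A`, the vectors it kills form a submodule; it contains `v`, so
  -- it is everything.
  let M : Submodule ℂ V :=
    { carrier := {w | ∀ a ∈ J, ∀ x, R.curAct S A V a x w = 0}
      add_mem' := fun hw hz a ha x => by rw [map_add, hw a ha, hz a ha, add_zero]
      zero_mem' := fun a _ x => map_zero _
      smul_mem' := fun c w hw a ha x => by rw [map_smul, hw a ha, smul_zero] }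
  let N : LieSubmodule ℂ (R.Current S A) V := lieSubmoduleOfStable M
    (fun x b w hw a ha y => by
      rw [curAct_curAct, hw a ha, map_zero, add_zero, hw _ (J.mul_mem_right b ha)])
    (fun t w hw a ha y => by
      have h := R.cartAct_curAct S 0 t a y w
      rw [hw a ha, hw a ha, map_zero, zero_add] at h
      exact h.symm)
  have hvN : v ∈ N := fun a ha x => hv.curAct_vector_eq_zero hS hJ ha x
  have hN : N = ⊤ := (IsSimpleOrder.eq_bot_or_eq_top N).resolve_left fun h =>
    hv.ne_zero ((LieSubmodule.mem_bot v).1 (h ▸ hvN))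
  exact (hN ▸ LieSubmodule.mem_top w : w ∈ N) a ha x

/-- It suffices to treat squares. If `a²` is in the ideal, so is `(ba)²` for each `b`; nilpotency
then gives `ψ(α_i^∨ ⊗ ba) = 0` for all `b`, which puts `a` in the ideal. -/
theorem isRadical_annihilator (hv : R.IsHighestWeightVector S V ψ v) (hS : IsCompl R.cartan' S)
    {i : ι} (hi : ∀ a : A, ∃ k : ℕ, ((R.curAct S A V a (R.f i)) ^ k) v = 0) :
    (hv.annihilator i).IsRadical := by
  rw [Ideal.isRadical_iff_quotient_reduced, isReduced_iff_pow_one_lt 2 one_lt_two]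
  intro z hz
  obtain ⟨a, rfl⟩ := Ideal.Quotient.mk_surjective z
  rw [← map_pow, Ideal.Quotient.eq_zero_iff_mem, sq] at hz
  rw [Ideal.Quotient.eq_zero_iff_mem]
  refine hv.mem_annihilator_of_map_eq_zero hS fun b => ?_
  obtain ⟨k, hk⟩ := hi (b * a)
  refine hv.map_coroot_eq_zero_of_sq ?_ hk
  rw [mul_mul_mul_comm]
  exact Ideal.mul_mem_left _ _ hz

end Irreducible

theorem isCofinite_iInf_annihilator (hv : R.IsHighestWeightVector S V ψ v)
    (hS : IsCompl R.cartan' S) (hfin : R.HasFiniteWeightSpaces S A V) :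
    IsCofinite (⨅ i, hv.annihilator i) := by
  -- Weights are functionals on `H`, so `ψ` on `h' ⊗ 1` and on `h''` is glued along the
  -- decomposition of `H`.
  let lam : Module.Dual ℂ H := ψ ∘ₗ
    (LinearMap.prodMap (TensorProduct.mk ℂ A R.cartan' 1) LinearMap.id) ∘ₗ
      (Submodule.prodEquivOfIsCompl _ _ hS).symm.toLinearMap
  have hlam (s : R.cartan') (t : S) : lam (s + t) = ψ (1 ⊗ₜ[ℂ] s, t) := by
    simp [lam]
  have hmem (a : A) (i : ι) :
      R.curAct S A V a (R.f i) v ∈ R.weightSpace S A V (lam - R.root i) := by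
    intro s t
    change R.cartAct S A V s t _ = _
    rw [cartAct_curAct, hv.cartan, adCartan_f, LinearMap.sub_apply, hlam, map_neg, map_smul, map_smul,
      LinearMap.neg_apply, LinearMap.smul_apply]
    module
  let g : A →ₗ[ℂ] ∀ i, R.weightSpace S A V (lam - R.root i) := LinearMap.pi fun i =>
    LinearMap.codRestrict _ (((R.curAct S A V).flip (R.f i)).flip v) fun a => hmem a i
  have hg : LinearMap.ker g = (⨅ i, hv.annihilator i : Ideal A).restrictScalars ℂ := by
    ext a
    rw [LinearMap.mem_ker, Submodule.restrictScalars_mem, Submodule.mem_iInf, funext_iff]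
    exact forall_congr' fun i => Subtype.ext_iff
  have (i : ι) := hfin (lam - R.root i)
  have : FiniteDimensional ℂ (A ⧸ LinearMap.ker g) :=
    Module.Finite.equiv g.quotKerEquivRange.symm
  rw [hg] at this
  exact Module.Finite.equiv (Submodule.Quotient.restrictScalarsEquiv ℂ (⨅ i, hv.annihilator i))

end IsHighestWeightVector

/-- The simple reflection negates its own root; this brings the `f_i` under the integrability
hypothesis. -/
theorem isRealRoot_neg_root (i : ι) : R.IsRealRoot (-R.root i) :=
  ⟨_, Subgroup.subset_closure ⟨i, rfl⟩, i, (Module.reflection_apply_self _).symm⟩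

theorem f_mem_rootSpace (i : ι) : (R.f i : R.Alg) ∈ R.rootSpace (-R.root i) := fun t => by
  rw [LinearMap.neg_apply, neg_smul]
  exact R.cartan_lie_gen_f t i

end Realization

end

end KacMoody

/-! ### Reduced finite-dimensional algebras, descent of the action, and copies of `g'`. -/

namespace KacMoody

noncomputable section

/-- Transport of a Lie module structure along an isomorphism of Lie algebras. -/
theorem exists_lieModule_of_lieEquiv {L L' V : Type*} [LieRing L] [LieAlgebra ℂ L] [LieRing L']
    [LieAlgebra ℂ L'] [AddCommGroup V] [Module ℂ V] [LieRingModule L V] [LieModule ℂ L V]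
    (Φ : L ≃ₗ⁅ℂ⁆ L') :
    ∃ (_ : LieRingModule L' V) (_ : LieModule ℂ L' V), ∀ (x : L) (v : V), ⁅Φ x, v⁆ = ⁅x, v⁆ :=
  ⟨LieRingModule.compLieHom V Φ.symm.toLieHom, LieModule.compLieHom V Φ.symm.toLieHom,
    fun x v => congrArg (fun y => ⁅y, v⁆) (Φ.symm_apply_apply x)⟩

/-- A finite-dimensional reduced commutative `ℂ`-algebra is a finite power of `ℂ`. -/
theorem exists_algEquiv_pi (B : Type*) [CommRing B] [Algebra ℂ B] [Module.Finite ℂ B]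
    [IsReduced B] : ∃ k : ℕ, Nonempty (B ≃ₐ[ℂ] (Fin k → ℂ)) := by
  have : IsArtinianRing B := IsArtinianRing.of_finite ℂ B
  let E₁ : B ≃ₐ[ℂ] ∀ m : MaximalSpectrum B, B ⧸ m.asIdeal :=
    (IsArtinianRing.equivPi B).restrictScalars ℂ
  -- Each residue field is integral over the algebraically closed field `ℂ`, hence equal to it.
  have hbij (m : MaximalSpectrum B) : Function.Bijective (algebraMap ℂ (B ⧸ m.asIdeal)) :=
    have := m.isMaximal.isPrime
    IsAlgClosed.algebraMap_bijective_of_isIntegral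
  let E₂ : (∀ m : MaximalSpectrum B, B ⧸ m.asIdeal) ≃ₐ[ℂ] (MaximalSpectrum B → ℂ) :=
    AlgEquiv.piCongrRight fun m =>
      (AlgEquiv.ofBijective (Algebra.ofId ℂ (B ⧸ m.asIdeal)) (hbij m)).symm
  exact ⟨_, ⟨(E₁.trans E₂).trans
    (AlgEquiv.piCongrLeft ℂ (fun _ => ℂ) (Finite.equivFin (MaximalSpectrum B)))⟩⟩

theorem IsCofinite.mono {A : Type*} [CommRing A] [Algebra ℂ A] {I J : Ideal A} (hI : IsCofinite I)
    (h : I ≤ J) : IsCofinite J :=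
  have : Module.Finite ℂ (A ⧸ I) := hI
  Module.Finite.of_surjective (Ideal.Quotient.factorₐ ℂ h).toLinearMap
    (Ideal.Quotient.factor_surjective h)

/-- A cofinite radical ideal is the intersection of the kernels of finitely many distinct
characters, which together identify the quotient with a power of `ℂ`. -/
theorem IsCofinite.exists_characters {A : Type*} [CommRing A] [Algebra ℂ A] {J : Ideal A}
    (hJ : IsCofinite J) (hrad : J.IsRadical) :
    ∃ (k : ℕ) (χ : Fin k → A →ₐ[ℂ] ℂ) (E : (A ⧸ J) ≃ₐ[ℂ] (Fin k → ℂ)),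
      Function.Injective χ ∧ J = ⨅ i, RingHom.ker (χ i) ∧
        ∀ a, E (Ideal.Quotient.mk J a) = fun i => χ i a := by
  have : Module.Finite ℂ (A ⧸ J) := hJ
  have : IsReduced (A ⧸ J) := (Ideal.isRadical_iff_quotient_reduced J).1 hrad
  obtain ⟨k, ⟨E⟩⟩ := exists_algEquiv_pi (A ⧸ J)
  refine ⟨k, fun i => (Pi.evalAlgHom ℂ (fun _ => ℂ) i).comp
    ((E : (A ⧸ J) →ₐ[ℂ] (Fin k → ℂ)).comp (Ideal.Quotient.mkₐ ℂ J)), E, ?_, ?_, fun a => rfl⟩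
  · intro i j hij
    -- A preimage of the `i`-th idempotent separates the `i`-th character from all others.
    obtain ⟨b, hb⟩ := E.surjective (Pi.single i 1)
    obtain ⟨a, rfl⟩ := Ideal.Quotient.mk_surjective b
    have h : E (Ideal.Quotient.mk J a) i = E (Ideal.Quotient.mk J a) j := DFunLike.congr_fun hij a
    by_contra hne
    rw [hb, Pi.single_eq_same, Pi.single_eq_of_ne (Ne.symm hne)] at h
    exact one_ne_zero h
  · ext a
    rw [← Ideal.Quotient.eq_zero_iff_mem, ← map_eq_zero_iff E E.injective, funext_iff, Ideal.mem_iInf]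
    rfl

namespace Realization

variable {ι : Type*} [Fintype ι] {C : Matrix ι ι ℤ} {H : Type*} [AddCommGroup H] [Module ℂ H]
  (R : Realization C H) (S : Submodule ℂ H) {A : Type*} [CommRing A] [Algebra ℂ A]

section Factor

attribute [local instance] LieRing.ofAssociativeRing

variable {V : Type*} [AddCommGroup V] [Module ℂ V] [LieRingModule (R.Current S A) V]
  [LieModule ℂ (R.Current S A) V]

/-- If `g' ⊗ ker π` acts as zero for a surjective homomorphism `π : A → B`, then the action of
`g_A` factors through `g_B`. -/
theorem exists_factor {B : Type*} [CommRing B] [Algebra ℂ B] {π : A →ₐ[ℂ] B}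
    (hπ : Function.Surjective π) (hker : ∀ a, π a = 0 → ∀ x, R.curAct S A V a x = 0) :
    ∃ (_ : LieRingModule (R.Current S B) V) (_ : LieModule ℂ (R.Current S B) V),
      ∀ (a : A) (x : R.derived) (t : S) (v : V),
        ⁅Current.mk R S (π a ⊗ₜ[ℂ] x) t, v⁆ = ⁅Current.mk R S (a ⊗ₜ[ℂ] x) t, v⁆ := by
  -- The section `σ` is only linear. This is enough: `σ (π a) - a` lies in `ker π`, so both act
  -- alike, and multiplicativity is checked on elements `π a`.
  obtain ⟨σ, hσ⟩ := π.toLinearMap.exists_rightInverse_of_surjective (LinearMap.range_eq_top.2 hπ)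
  have hσ' (a : A) : R.curAct S A V (σ (π a)) = R.curAct S A V a := by
    ext1 x
    rw [← sub_eq_zero, ← LinearMap.sub_apply, ← map_sub]
    refine hker _ ?_ x
    rw [map_sub, sub_eq_zero]
    exact LinearMap.congr_fun hσ (π a)
  let τ : B ⊗[ℂ] R.derived →ₗ[ℂ] Module.End ℂ V := TensorProduct.lift (R.curAct S A V ∘ₗ σ)
  have hτ (a : A) (x : R.derived) : τ (π a ⊗ₜ x) = R.curAct S A V a x := by
    rw [TensorProduct.lift.tmul, LinearMap.comp_apply, hσ']
  let T : AbelianLie S →ₗ⁅ℂ⁆ Module.End ℂ V :=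
    (LieModule.toEnd ℂ (R.Current S A) V).comp (LieAlgebra.SemiDirectSum.inr (R.complAct S A))
  have hττ (y z : B ⊗[ℂ] R.derived) : τ ⁅y, z⁆ = ⁅τ y, τ z⁆ := by
    induction y using TensorProduct.induction_on with
    | zero => simp
    | add y₁ y₂ h₁ h₂ => rw [add_lie, map_add, map_add, h₁, h₂, add_lie]
    | tmul a x =>
      induction z using TensorProduct.induction_on with
      | zero => simp
      | add z₁ z₂ h₁ h₂ => rw [lie_add, map_add, map_add, h₁, h₂, lie_add]
      | tmul b y =>
        obtain ⟨a, rfl⟩ := hπ a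
        obtain ⟨b, rfl⟩ := hπ b
        rw [LieAlgebra.ExtendScalars.bracket_tmul, ← map_mul, hτ, hτ, hτ]
        ext w
        exact R.curAct_lie S a b x y w
  have hTτ (t : AbelianLie S) (z : B ⊗[ℂ] R.derived) :
      τ (R.complAct S B t z) = ⁅T t, τ z⁆ := by
    induction z using TensorProduct.induction_on with
    | zero => simp
    | add z₁ z₂ h₁ h₂ => rw [map_add, map_add, map_add, h₁, h₂, lie_add]
    | tmul b y =>
      obtain ⟨b, rfl⟩ := hπ b
      change τ (π b ⊗ₜ R.adCartan _ y) = _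
      rw [hτ, hτ]
      have hT : T t = R.cartAct S A V 0 ((AbelianLie.of S).symm t) := by
        ext w
        rw [cartAct_apply, map_zero, TensorProduct.tmul_zero]
        rfl
      ext w
      have h := R.cartAct_curAct S 0 ((AbelianLie.of S).symm t) b y w
      rw [← sub_eq_iff_eq_add, Submodule.coe_zero, zero_add] at h
      rw [hT]
      exact h.symm
  let ρ : R.Current S B →ₗ⁅ℂ⁆ Module.End ℂ V :=
    { toFun := fun z => τ z.left + T z.right
      map_add' := fun y z => by
        change τ (y.left + z.left) + T (y.right + z.right) = _
        rw [map_add, map_add]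
        abel
      map_smul' := fun c z => by
        change τ (c • z.left) + T (c • z.right) = c • _
        rw [map_smul, map_smul, smul_add]
      map_lie' := fun {y z} => by
        change τ (⁅y.left, z.left⁆ + R.complAct S B y.right z.left -
          R.complAct S B z.right y.left) + T ⁅y.right, z.right⁆ = _
        rw [map_sub, map_add, hττ, hTτ, hTτ, LieHom.map_lie, lie_add, add_lie, add_lie,
          ← lie_skew (τ y.left) (T z.right)]
        abel }
  refine ⟨LieRingModule.compLieHom V ρ, LieModule.compLieHom V ρ, fun a x t v => ?_⟩
  change (τ (π a ⊗ₜ x) + T t) v = _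
  rw [hτ, LinearMap.add_apply, curAct_apply]
  change _ + ⁅Current.mk R S 0 t, v⁆ = _
  rw [← add_lie]
  congr 1
  exact LieAlgebra.SemiDirectSum.ext (add_zero _) (zero_add _)

end Factor

variable {R S}

/-- `B ⊗ g'` becomes `ℂ^k ⊗ g'`, that is, `k` copies of `g'`. Brackets match because `E` is
multiplicative, and `h''` acts only on the factor `g'`. -/
theorem exists_current_equiv_copies {B : Type*} [CommRing B] [Algebra ℂ B] {k : ℕ}
    (E : B ≃ₐ[ℂ] (Fin k → ℂ)) : ∃ Φ : R.Current S B ≃ₗ⁅ℂ⁆ R.Copies S k,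
      ∀ (b : B) (x : R.derived) (t : S),
        Φ (Current.mk R S (b ⊗ₜ[ℂ] x) t) = Copies.mk R S (fun i => E b i • x) t := by
  let θ : B ⊗[ℂ] R.derived ≃ₗ[ℂ] (Fin k → R.derived) :=
    (TensorProduct.congr E.toLinearEquiv (LinearEquiv.refl ℂ R.derived)).trans
      ((TensorProduct.comm ℂ _ _).trans (TensorProduct.piScalarRight ℂ ℂ R.derived (Fin k)))
  have hθ (b : B) (x : R.derived) : θ (b ⊗ₜ x) = fun i => E b i • x := by
    ext1 i
    simp [θ]
  have hlie (y z : B ⊗[ℂ] R.derived) : θ ⁅y, z⁆ = ⁅θ y, θ z⁆ := by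
    induction y using TensorProduct.induction_on with
    | zero => simp
    | add y₁ y₂ h₁ h₂ => rw [add_lie, map_add, map_add, h₁, h₂, add_lie]
    | tmul a x =>
      induction z using TensorProduct.induction_on with
      | zero => simp
      | add z₁ z₂ h₁ h₂ => rw [lie_add, map_add, map_add, h₁, h₂, lie_add]
      | tmul b y =>
        rw [LieAlgebra.ExtendScalars.bracket_tmul, hθ, hθ, hθ]
        ext1 i
        change _ = ⁅E a i • x, E b i • y⁆
        rw [map_mul, Pi.mul_apply, smul_lie, lie_smul, smul_smul]
  have hact (t : AbelianLie S) (z : B ⊗[ℂ] R.derived) :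
      θ (R.complAct S B t z) = R.complActCopies S k t (θ z) := by
    induction z using TensorProduct.induction_on with
    | zero => simp
    | add z₁ z₂ h₁ h₂ => rw [map_add, map_add, map_add, h₁, h₂, map_add]
    | tmul b y =>
      change θ (b ⊗ₜ R.adCartan _ y) = _
      rw [hθ, hθ]
      ext1 i
      exact (map_smul (R.adCartan _) (E b i) y).symm
  refine ⟨{ toFun := fun z => ⟨θ z.left, z.right⟩
            invFun := fun z => ⟨θ.symm z.left, z.right⟩
            map_add' := fun y z => LieAlgebra.SemiDirectSum.ext (map_add θ _ _) rfl
            map_smul' := fun c z => LieAlgebra.SemiDirectSum.ext (map_smul θ _ _) rfl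
            map_lie' := ?_
            left_inv := fun z => LieAlgebra.SemiDirectSum.ext (θ.symm_apply_apply _) rfl
            right_inv := fun z => LieAlgebra.SemiDirectSum.ext (θ.apply_symm_apply _) rfl }, ?_⟩
  · rintro ⟨y, t⟩ ⟨z, u⟩
    refine LieAlgebra.SemiDirectSum.ext ?_ rfl
    change θ (⁅y, z⁆ + R.complAct S B t z - R.complAct S B u y) =
      ⁅θ y, θ z⁆ + R.complActCopies S k t (θ z) - R.complActCopies S k u (θ y)
    rw [map_sub, map_add, hlie, hact, hact]
  · intro b x t
    exact LieAlgebra.SemiDirectSum.ext (hθ b x) rfl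

end Realization

end

end KacMoody

/-! ### The main theorem. -/

open scoped TensorProduct in
theorem theorem3p3 {ι : Type*} [Fintype ι] {C : Matrix ι ι ℤ}
    {H : Type*} [AddCommGroup H] [Module ℂ H]
    (R : KacMoody.Realization C H)
    (S : Submodule ℂ H) (hS : IsCompl R.cartan' S)
    {A : Type*} [CommRing A] [Algebra ℂ A] [Algebra.FiniteType ℂ A]
    {V : Type*} [AddCommGroup V] [Module ℂ V]
    [LieRingModule (R.Current S A) V] [LieModule ℂ (R.Current S A) V]
    [LieModule.IsIrreducible ℂ (R.Current S A) V]
    (ψ : (A ⊗[ℂ] R.cartan') × S →ₗ[ℂ] ℂ)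
    (hψ : R.IsHighestWeight S A V ψ)
    (hint : R.IsIntegrable S A V)
    (hfin : R.HasFiniteWeightSpaces S A V) :
    (∃ I : Ideal A, KacMoody.IsCofinite I ∧
      ∀ a ∈ I, ∀ t : R.cartan', ψ (a ⊗ₜ[ℂ] t, 0) = 0) ∧
    ∀ I J : Ideal A, KacMoody.IsCofinite I →
      (∀ a ∈ I, ∀ t : R.cartan', ψ (a ⊗ₜ[ℂ] t, 0) = 0) →
      J = I.radical →
      J.IsRadical ∧ KacMoody.IsCofinite J ∧
      (∀ a ∈ J, ∀ (x : R.derived) (v : V),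
        ⁅KacMoody.Realization.Current.mk R S (a ⊗ₜ[ℂ] x) 0, v⁆ = 0) ∧
      (∃ (_ : LieRingModule (R.Current S (A ⧸ J)) V) (_ : LieModule ℂ (R.Current S (A ⧸ J)) V),
        ∀ (a : A) (x : R.derived) (t : S) (v : V),
          ⁅KacMoody.Realization.Current.mk R S (Ideal.Quotient.mk J a ⊗ₜ[ℂ] x) t, v⁆ =
            ⁅KacMoody.Realization.Current.mk R S (a ⊗ₜ[ℂ] x) t, v⁆) ∧
      ∃ (k : ℕ) (χ : Fin k → A →ₐ[ℂ] ℂ),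
        Function.Injective χ ∧ J = ⨅ i, RingHom.ker (χ i) ∧
        (∃ Φ : R.Current S (A ⧸ J) ≃ₗ⁅ℂ⁆ R.Copies S k,
          ∀ (a : A) (x : R.derived) (t : S),
            Φ (KacMoody.Realization.Current.mk R S (Ideal.Quotient.mk J a ⊗ₜ[ℂ] x) t) =
              KacMoody.Realization.Copies.mk R S (fun i => χ i a • x) t) ∧
        ∃ (_ : LieRingModule (R.Copies S k) V) (_ : LieModule ℂ (R.Copies S k) V),
          ∀ (a : A) (x : R.derived) (t : S) (v : V),
            ⁅KacMoody.Realization.Copies.mk R S (fun i => χ i a • x) t, v⁆ =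
              ⁅KacMoody.Realization.Current.mk R S (a ⊗ₜ[ℂ] x) t, v⁆ := by
  obtain ⟨v, hv⟩ := KacMoody.Realization.IsHighestWeight.exists_vector R S hψ
  refine ⟨⟨⨅ i, hv.annihilator i, hv.isCofinite_iInf_annihilator hS hfin, fun a ha t =>
    hv.map_cartan'_eq_zero (fun i => (Ideal.mem_iInf.1 ha) i) t⟩, ?_⟩
  rintro I J hI hψI rfl
  -- For `a ∈ I` all `ba` lie in `I`, so `ψ` vanishes on `α_i^∨ ⊗ ba` and `I` lies in the
  -- annihilator; radicality of the latter absorbs `√I`.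
  have hJle (i : ι) : I.radical ≤ hv.annihilator i :=
    (hv.isRadical_annihilator hS fun a => hint.2 _ (R.isRealRoot_neg_root i) (R.f i)
      (R.f_mem_rootSpace i) a v).radical_le_iff.2 fun a ha =>
        hv.mem_annihilator_of_map_eq_zero hS fun b => hψI _ (I.mul_mem_left b ha) _
  have hzero (a) (ha : a ∈ I.radical) (x : R.derived) (w : V) : R.curAct S A V a x w = 0 :=
    hv.curAct_eq_zero hS hJle ha x w
  have hJ : KacMoody.IsCofinite I.radical := hI.mono Ideal.le_radical
  obtain ⟨i₁, i₂, hfac⟩ := R.exists_factor S (V := V) (π := Ideal.Quotient.mkₐ ℂ I.radical)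
    Ideal.Quotient.mk_surjective fun a ha x =>
      LinearMap.ext (hzero a (Ideal.Quotient.eq_zero_iff_mem.1 ha) x)
  obtain ⟨k, χ, E, hχ, hker, hE⟩ := hJ.exists_characters (Ideal.radical_isRadical I)
  obtain ⟨Φ, hΦ⟩ := KacMoody.Realization.exists_current_equiv_copies (R := R) (S := S) E
  have hΦ' (a : A) (x : R.derived) (t : S) :
      Φ (KacMoody.Realization.Current.mk R S (Ideal.Quotient.mk I.radical a ⊗ₜ[ℂ] x) t) =
        KacMoody.Realization.Copies.mk R S (fun i => χ i a • x) t := by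
    rw [hΦ, hE]
  obtain ⟨j₁, j₂, hcop⟩ := KacMoody.exists_lieModule_of_lieEquiv (V := V) Φ
  refine ⟨Ideal.radical_isRadical I, hJ, hzero, ⟨i₁, i₂, hfac⟩, k, χ, hχ, hker, ⟨Φ, hΦ'⟩,
    j₁, j₂, fun a x t w => ?_⟩
  rw [← hΦ', hcop]
  exact hfac a x t w
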